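/- Let $d\in\{2,3\}$, $T>0$, and let $\hat\Omega\subset\mathbb R^d$ be the union of a finite conforming family of closed $d$-simplices $\hat K$ (the reference mesh). For $t\in[0,T]$ let $\mathcal A_t:\hat\Omega\to\Omega_t:=\mathcal A_t(\hat\Omega)$ be a bijective ALE map, affine on every $\hat K$, with $t\mapsto\mathcal A_t(Y)$ of class $C^1$ on $[0,T]$ for each $Y\in\hat\Omega$. The cells at time $t$ are $K=\mathcal A_t(\hat K)$; they form $\mathcal T_{h,t}$, and $h_K$ is the diameter of $K$. The mesh velocity is $w_h(t,x)=\partial_t\mathcal A_t(Y)$, and $\partial_t u|_Y(t,x)=\frac{d}{dt}\big[u(t,\mathcal A_t(Y))\big]$, both at $Y=\mathcal A_t^{-1}(x)$. For a fixed degree $k$, let $V_h=V_h(t)$ be the space of continuous functions on $\Omega_t$ that vanish on $\partial\Omega_t$ and are polynomials of degree at most $k$ on each cell. Norms $\|\cdot\|_0$, $\|\cdot\|_{0,K}$ and inner products $(\cdot,\cdot)$, $(\cdot,\cdot)_K$ are those of $L^2(\Omega_t)$ and $L^2(K)$. Let $\epsilon>0$; let $b$ be a vector field that is continuous on $\{(t,x):0\le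 t\le T,\ x\in\Omega_t\}$ and Lipschitz in $x$ for each $t\in(0,T]$; let $c(t,\cdot)\in L^\infty(\Omega_t)$ and $f(t,\cdot)\in L^2(\Omega_t)$ for each $t\in(0,T]$, with $\int_0^T\|f\|_0^2\,dt<\infty$; and let $\delta_K=\delta_K(t)\ge 0$ be measurable in $t$. Set $$a_{SUPG}(u,v)=\epsilon(\nabla u,\nabla v)+(b\cdot\nabla u,v)+(cu,v)+\sum_{K\in\mathcal T_{h,t}}\delta_K\big(-\epsilon\Delta u+(b-w_h)\cdot\nabla u+cu,\ (b-w_h)\cdot\nabla v\big)_K .$$ Let $u_h(t,\cdot)\in V_h(t)$, $t\in[0,T]$, solve the semi-discrete ALE-SUPG problem: $t\mapsto u_h(t,\mathcal A_t(Y))$ is continuous on $[0,T]$ and differentiable on $(0,T]$ for each $Y\in\hat\Omega$; $u_h(0)$ is the $L^2$-projection onto $V_h(0)$ of an initial datum $u_0\in L^2(\Omega_0)$; and for all $t\in(0,T]$ and all $v_h\in V_h(t)$ $$\big(\partial_t u_h|_Y,v_h\big)+a_{SUPG}(u_h,v_h)-(w_h\cdot\nabla u_h,v_h)=(f,v_h)+\sum_{K\in\mathcal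 T_{h,t}}\delta_K\big(f,(b-w_h)\cdot\nabla v_h\big)_K .$$ Assume that for some constant $\mu>0$ and every $t\in(0,T]$, $c-\tfrac12\nabla\cdot b\ge\mu$ almost everywhere in $\Omega_t$. Let $c_{inv}>0$ be a constant of the inverse inequality, i.e. $\|\Delta v_h\|_{0,K}\le c_{inv}h_K^{-1}\|\nabla v_h\|_{0,K}$ for all $t\in(0,T]$, $v_h\in V_h(t)$ and $K\in\mathcal T_{h,t}$. Assume that for all $t\in(0,T]$ and $K\in\mathcal T_{h,t}$ $$\delta_K\le\frac{\mu}{2\|c\|_{L^\infty(K)}^2},\qquad \delta_K\le\frac{h_K^2}{2\epsilon c_{inv}^2},$$ where the first condition is void if $c=0$ almost everywhere on $K$. Let $$|||u|||^2=\epsilon\|\nabla u\|_0^2+\sum_{K\in\mathcal T_{h,t}}\delta_K\|(b-w_h)\cdot\nabla u\|_{0,K}^2+\mu\|u\|_0^2 .$$ Then $t\mapsto|||u_h(t)|||^2$ is integrable on $(0,T)$, and for every $\tau\in[0,T]$ (in particular for $\tau=T$) $$\|u_h(\tau)\|_0^2+\frac12\int_0^\tau|||u_h|||^2\,dt\le\|u_h(0)\|_0^2+\frac2\mu\int_0^\tau\|f\|_0^2\,dt+2\int_0^\tau\sum_{K\in\mathcal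 T_{h,t}}\delta_K\|f\|_{0,K}^2\,dt .$$ In particular, the constants in the bound do not depend on the mesh velocity. -/

import Mathlib

open MeasureTheory Set
open scoped NNReal

noncomputable section

namespace ALESUPG

/-- The Euclidean space `ℝᵈ`. -/
abbrev Space (d : ℕ) : Type := EuclideanSpace ℝ (Fin d)

/-- A reference domain triangulated into finitely many `d`-simplices, together with a
semi-discrete (continuous in time) ALE map, which is affine on every reference cell. -/
structure MovingMesh (d : ℕ) (T : ℝ) where
  /-- the conforming simplicial decomposition of the (closed) reference domain -/
  ref : Geometry.SimplicialComplex ℝ (Space d)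
  /-- the reference cells, each given by its `d + 1` vertices -/
  cells : Finset (Finset (Space d))
  mem_cells : ∀ s, s ∈ cells ↔ s ∈ ref.faces ∧ s.card = d + 1
  /-- every vertex, edge, ... belongs to a cell -/
  pure : ∀ s ∈ ref.faces, ∃ t ∈ cells, s ⊆ t
  /-- the ALE map `(t, Y) ↦ 𝒜ₜ(Y)` -/
  ale : ℝ → Space d → Space d
  ale_affine : ∀ t ∈ Icc 0 T, ∀ s ∈ cells,
    ∃ g : Space d →ᵃ[ℝ] Space d, EqOn (ale t) g (convexHull ℝ (s : Set (Space d)))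
  ale_injOn : ∀ t ∈ Icc 0 T, InjOn (ale t) ref.space
  ale_contDiffOn : ∀ Y ∈ ref.space, ContDiffOn ℝ 1 (fun t => ale t Y) (Icc 0 T)

namespace MovingMesh

variable {d : ℕ} {T : ℝ} (M : MovingMesh d T)

/-- The closed moving domain at time `t`. -/
def domain (t : ℝ) : Set (Space d) := M.ale t '' M.ref.space

/-- The cell `K` of the triangulation at time `t` that is the image of the reference cell with
vertex set `s`. -/
def cell (s : Finset (Space d)) (t : ℝ) : Set (Space d) :=
  M.ale t '' convexHull ℝ (s : Set (Space d))

/-- The diameter `h_{K,t}` of a cell. -/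
def cellDiam (s : Finset (Space d)) (t : ℝ) : ℝ := Metric.diam (M.cell s t)

/-- The closed space-time domain. -/
def spaceTime : Set (ℝ × Space d) := {p | p.1 ∈ Icc 0 T ∧ p.2 ∈ M.domain p.1}

/-- The reference point `𝒜ₜ⁻¹(x)`. -/
def aleInv (t : ℝ) (x : Space d) : Space d := Function.invFunOn (M.ale t) M.ref.space x

/-- The mesh velocity `w_h(t, x) = ∂ₜ 𝒜ₜ(Y)` at `Y = 𝒜ₜ⁻¹(x)`. -/
def velocity (t : ℝ) (x : Space d) : Space d :=
  derivWithin (fun τ => M.ale τ (M.aleInv t x)) (Icc 0 T) t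

/-- The time derivative `∂u/∂t|_Y` on the ALE frame, in Eulerian coordinates. -/
def aleDeriv (u : ℝ → Space d → ℝ) (t : ℝ) (x : Space d) : ℝ :=
  derivWithin (fun τ => u τ (M.ale τ (M.aleInv t x))) (Icc 0 T) t

/-- `v ∈ V_h` at time `t`: continuous on the closed domain, zero on its boundary, and on every
cell a polynomial of degree at most `k`. Values outside the domain are irrelevant. -/
structure IsFE (k : ℕ) (t : ℝ) (v : Space d → ℝ) : Prop where
  continuousOn : ContinuousOn v (M.domain t)
  boundary : ∀ x ∈ frontier (M.domain t), v x = 0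
  polynomial : ∀ s ∈ M.cells, ∃ p : MvPolynomial (Fin d) ℝ, p.totalDegree ≤ k ∧
    ∀ x ∈ M.cell s t, v x = MvPolynomial.eval (fun i => x i) p

end MovingMesh

variable {d : ℕ} {T : ℝ}

/-- The divergence of a vector field. -/
def divergence (b : Space d → Space d) (x : Space d) : ℝ :=
  ∑ i, (fderiv ℝ b x (EuclideanSpace.single i 1)) i

/-- The squared `L²`-norm on a set. -/
def normSq {F : Type*} [NormedAddCommGroup F] (S : Set (Space d)) (g : Space d → F) : ℝ :=
  ∫ x in S, ‖g x‖ ^ 2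

/-- The `L^∞`-norm on a set. -/
def supNorm (S : Set (Space d)) (g : Space d → ℝ) : ℝ :=
  (eLpNorm g ⊤ (volume.restrict S)).toReal

/-- The inverse inequality `‖Δv‖_{0,K} ≤ C h_K⁻¹ |v|_{1,K}` holds for all finite element functions,
all cells and all times. (Inside a cell, `v` is a polynomial, so its gradient and Laplacian there
are the elementwise ones; the boundaries of cells are null sets.) -/
def InverseInequality (M : MovingMesh d T) (k : ℕ) (C : ℝ) : Prop :=
  ∀ t ∈ Ioc 0 T, ∀ v, M.IsFE k t v → ∀ s ∈ M.cells,
    √(normSq (M.cell s t) (Laplacian.laplacian v))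
      ≤ C * (M.cellDiam s t)⁻¹ * √(normSq (M.cell s t) (gradient v))

/-- The data: diffusivity, convective velocity, reaction, source, and the local stabilization
parameters `δ_K(t)`, where a cell `K` is given by its reference vertices. -/
structure Data (d : ℕ) where
  ε : ℝ
  b : ℝ → Space d → Space d
  c : ℝ → Space d → ℝ
  f : ℝ → Space d → ℝ
  δ : Finset (Space d) → ℝ → ℝ

/-- The convective derivative `(b - w_h) · ∇v`. -/
def convect (M : MovingMesh d T) (D : Data d) (t : ℝ) (v : Space d → ℝ) (x : Space d) : ℝ :=
  inner ℝ (D.b t x - M.velocity t x) (gradient v x)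

/-- The form `a_SUPG(u, v)` at time `t`. -/
def aSUPG (M : MovingMesh d T) (D : Data d) (t : ℝ) (u v : Space d → ℝ) : ℝ :=
  D.ε * (∫ x in M.domain t, inner ℝ (gradient u x) (gradient v x))
    + (∫ x in M.domain t, inner ℝ (D.b t x) (gradient u x) * v x)
    + (∫ x in M.domain t, D.c t x * u x * v x)
    + ∑ s ∈ M.cells, D.δ s t * ∫ x in M.cell s t,
        (-D.ε * Laplacian.laplacian u x + convect M D t u x + D.c t x * u x)
          * convect M D t v x

/-- The squared mesh-dependent norm `|||u|||²` at time `t`. -/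
def tripleNormSq (M : MovingMesh d T) (D : Data d) (μ t : ℝ) (u : Space d → ℝ) : ℝ :=
  D.ε * normSq (M.domain t) (gradient u)
    + (∑ s ∈ M.cells, D.δ s t * normSq (M.cell s t) (convect M D t u))
    + μ * normSq (M.domain t) u

/-- `u` solves the semi-discrete (continuous in time) ALE-SUPG problem with initial datum `u₀`. -/
structure IsSemidiscreteSolution (M : MovingMesh d T) (k : ℕ) (D : Data d) (u₀ : Space d → ℝ)
    (u : ℝ → Space d → ℝ) : Prop where
  isFE : ∀ t ∈ Icc 0 T, M.IsFE k t (u t)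
  continuousOn : ∀ Y ∈ M.ref.space, ContinuousOn (fun t => u t (M.ale t Y)) (Icc 0 T)
  differentiableOn : ∀ Y ∈ M.ref.space, ∀ t ∈ Ioc 0 T,
    DifferentiableWithinAt ℝ (fun τ => u τ (M.ale τ Y)) (Icc 0 T) t
  /-- `u(0)` is the `L²`-projection of `u₀` onto the finite element space -/
  initial : ∀ v, M.IsFE k 0 v → ∫ x in M.domain 0, (u 0 x - u₀ x) * v x = 0
  equation : ∀ t ∈ Ioc 0 T, ∀ v, M.IsFE k t v →
    (∫ x in M.domain t, M.aleDeriv u t x * v x) + aSUPG M D t (u t) v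
        - (∫ x in M.domain t, inner ℝ (M.velocity t x) (gradient (u t) x) * v x)
      = (∫ x in M.domain t, D.f t x * v x)
        + ∑ s ∈ M.cells, D.δ s t * ∫ x in M.cell s t, D.f t x * convect M D t v x

/-- Standing regularity assumptions on the data. -/
structure Data.IsRegular (D : Data d) (M : MovingMesh d T) : Prop where
  ε_pos : 0 < D.ε
  b_continuousOn : ContinuousOn (fun p : ℝ × Space d => D.b p.1 p.2) M.spaceTime
  b_lipschitz : ∀ t ∈ Ioc 0 T, ∃ L : ℝ≥0, LipschitzOnWith L (D.b t) (M.domain t)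
  c_bounded : ∀ t ∈ Ioc 0 T, MemLp (D.c t) ⊤ (volume.restrict (M.domain t))
  f_memLp : ∀ t ∈ Ioc 0 T, MemLp (D.f t) 2 (volume.restrict (M.domain t))
  f_memLp_spaceTime :
    MemLp (fun p : ℝ × Space d => D.f p.1 p.2) 2 (volume.restrict M.spaceTime)
  δ_nonneg : ∀ s ∈ M.cells, ∀ t ∈ Ioc 0 T, 0 ≤ D.δ s t
  δ_measurable : ∀ s ∈ M.cells, AEMeasurable (D.δ s) (volume.restrict (Ioc 0 T))

end ALESUPG

end

/-! Energy method: test the discrete equation with `u` itself. By Reynolds' transport theorem, d/dt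
‖u‖² = 2 (∂ₜu|_Y, u) + ∫ (∇·w_h) u², and since `u` vanishes on the boundary the last integral equals
-2 (w_h·∇u, u). The sum is exactly twice the two corresponding terms of the tested equation, so the
mesh velocity survives only inside the stabilization terms and no Gronwall argument is needed. The
same integration by parts with `b` turns convection plus reaction into ∫ (c - ½∇·b) u² ≥ μ‖u‖².
Young's inequality, the inverse inequality and the two bounds on δ_K absorb the source and the
stabilization (`stabilization_bound`), leaving half of the squared mesh-dependent norm
(`deriv_normSq_le`).

Three points need care. Time regularity is assumed only at each material point. On a reference cell,
however, `u` is a finite sum of nodal values times fixed polynomials (`nonempty_nodalForm`), and the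
ALE map is affine with C¹ coefficients (`nonempty_cellChart`), so the transport theorem reduces to
the product rule and Jacobi's formula (`hasDeriv_normSq_cell`). The domain is only a union of
simplices and w_h is only cellwise affine, so `integral_divergence_mul_sq` works with Lipschitz
extensions by zero on the whole space. Finally, δ_K is only measurable in time, and `energy_bound`
extracts the integrability of the norm from the differential inequality itself. -/

namespace ALESUPG

/-! ### Lipschitz functions on finite closed covers -/

/-- A continuous function on `[0,1]` that is Lipschitz on the members of a finite closed cover has
increment at most the Lipschitz constant. -/
theorem norm_sub_le_of_finite_closed_cover {F ι : Type*} [NormedAddCommGroup F] [Finite ι]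
    {f : ℝ → F} (hf : ContinuousOn f (Icc 0 1)) {C : ℝ} {S : ι → Set ℝ}
    (hS : ∀ i, IsClosed (S i)) (hcover : Icc 0 1 ⊆ ⋃ i, S i)
    (hL : ∀ i, ∀ x ∈ S i ∩ Icc 0 1, ∀ y ∈ S i ∩ Icc 0 1, ‖f y - f x‖ ≤ C * |y - x|) :
    ‖f 1 - f 0‖ ≤ C := by
  -- The slack `e` supplies the strict inequality `C < C + e` between slopes that the comparison
  -- principle demands.
  refine le_of_forall_pos_le_add fun e he => ?_
  have key := image_norm_le_of_liminf_right_slope_norm_lt_deriv_boundary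
    (f := fun x => f x - f 0) (a := 0) (b := 1) (f' := fun _ => C)
    (B := fun x => (C + e) * x) (B' := fun _ => C + e)
    (hf.sub continuousOn_const) ?_ (by simp) (by fun_prop) ?_ ?_ (right_mem_Icc.2 zero_le_one)
  · simpa using key
  · intro x hx r hr
    -- Pigeonhole: one of the finitely many sets contains points arbitrarily close to `x` on its
    -- right, hence also `x` by closedness. A slope bound along these points is enough for a lower
    -- limit.
    have : ∃ᶠ z in nhdsWithin x (Ioi x), ∃ i, z ∈ S i ∩ Ioo x 1 := by
      refine Filter.Eventually.frequently ?_
      filter_upwards [Ioo_mem_nhdsGT hx.2] with z hz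
      obtain ⟨i, hi⟩ := mem_iUnion.1 (hcover ⟨hx.1.trans hz.1.le, hz.2.le⟩)
      exact ⟨i, hi, hz⟩
    obtain ⟨i, hi⟩ := Filter.frequently_exists.1 this
    have hxi : x ∈ S i := by
      rw [← (hS i).closure_eq, mem_closure_iff_frequently]
      exact (hi.filter_mono nhdsWithin_le_nhds).mono fun z hz => hz.1
    refine hi.mono fun z hz => ?_
    have h1 := hL i x ⟨hxi, hx.1, hx.2.le⟩ z ⟨hz.1, hx.1.trans hz.2.1.le, hz.2.2.le⟩
    have hpos : 0 < z - x := sub_pos.2 hz.2.1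
    have h2 := norm_sub_norm_le (f z - f 0) (f x - f 0)
    rw [sub_sub_sub_cancel_right] at h2
    rw [abs_of_pos hpos] at h1
    refine lt_of_le_of_lt ?_ hr
    rw [slope_def_field, div_le_iff₀ hpos]
    exact h2.trans h1
  · intro x _
    simpa using ((hasDerivAt_id x).const_mul (C + e)).hasDerivWithinAt
  · intro x _ _
    linarith

/-- A continuous function that is Lipschitz on each set of a finite closed cover is Lipschitz. -/
theorem lipschitzWith_of_finite_closed_cover {E F ι : Type*} [NormedAddCommGroup E]
    [NormedSpace ℝ E] [NormedAddCommGroup F] [Finite ι] {f : E → F} (hf : Continuous f) {C : ℝ≥0}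
    {S : ι → Set E} (hS : ∀ i, IsClosed (S i)) (hcover : ⋃ i, S i = univ)
    (hL : ∀ i, LipschitzOnWith C f (S i)) : LipschitzWith C f := by
  refine LipschitzWith.of_dist_le_mul fun x y => ?_
  have hγ : Continuous fun r : ℝ => AffineMap.lineMap (k := ℝ) y x r :=
    AffineMap.lineMap_continuous
  have := norm_sub_le_of_finite_closed_cover (f := fun r : ℝ => f (AffineMap.lineMap y x r))
    (C := C * dist x y) (S := fun i => (fun r : ℝ => AffineMap.lineMap (k := ℝ) y x r) ⁻¹' S i)
    (hf.comp hγ).continuousOn (fun i => (hS i).preimage hγ)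
    (by rw [← preimage_iUnion, hcover]; simp) ?_
  · simpa [dist_eq_norm] using this
  · rintro i r ⟨hr, -⟩ q ⟨hq, -⟩
    have := (hL i).dist_le_mul _ hq _ hr
    rw [dist_lineMap_lineMap, Real.dist_eq, dist_comm y x] at this
    rw [← dist_eq_norm]
    linarith

/-! ### Nodal representation -/

/-- A finite-dimensional space of functions has a nodal representation. -/
theorem exists_nodal_representation {V X : Type*} [AddCommGroup V] [Module ℝ V]
    [FiniteDimensional ℝ V] (L : V →ₗ[ℝ] X → ℝ) :
    ∃ (n : ℕ) (Y : Fin n → X) (φ : Fin n → V), ∀ p x, L p x = ∑ i, L p (Y i) * L (φ i) x := by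
  classical
  let ev : X → Module.Dual ℝ V := fun x => LinearMap.proj x ∘ₗ L
  obtain ⟨b, hb, hspan, hli⟩ := exists_linearIndependent ℝ (range ev)
  -- The nodes are points whose evaluations form a basis of the span of all evaluations; there are
  -- finitely many because the dual of `V` is finite-dimensional.
  have hfin : b.Finite := hli.setFinite
  choose Y₀ hY₀ using fun f : b => hb f.2
  have : Fintype b := hfin.fintype
  let e := (Fintype.equivFin b).symm
  let Y : Fin (Fintype.card b) → X := fun i => Y₀ (e i)
  have hY : ∀ i, ev (Y i) = e i := fun i => hY₀ (e i)
  let ψ : V →ₗ[ℝ] (Fin (Fintype.card b) → ℝ) := LinearMap.pi fun i => ev (Y i)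
  have hker : ∀ p, ψ p = 0 → L p = 0 := by
    intro p hp
    ext x
    have hx : ev x ∈ Submodule.span ℝ b := hspan ▸ Submodule.subset_span ⟨x, rfl⟩
    have : Submodule.span ℝ b ≤ LinearMap.ker (LinearMap.applyₗ (R := ℝ) (M₂ := ℝ) p) := by
      rw [Submodule.span_le]
      intro f hf
      have := congrFun hp (e.symm ⟨f, hf⟩)
      simp only [ψ, LinearMap.pi_apply, hY, Equiv.apply_symm_apply] at this
      simpa using this
    simpa [ev] using this hx
  -- The shape functions come from a linear section `σ` of the nodal evaluation `ψ`. Since `σ (ψ p)`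
  -- and `p` agree at the nodes, `hker` makes them the same function.
  obtain ⟨r, hr⟩ := ψ.rangeRestrict.exists_rightInverse_of_surjective ψ.range_rangeRestrict
  obtain ⟨σ, hσ⟩ := LinearMap.exists_extend r
  refine ⟨_, Y, fun i => σ (Pi.single i 1), fun p x => ?_⟩
  have h1 : ψ (σ (ψ p)) = ψ p := by
    have h2 : σ (ψ p) = r (ψ.rangeRestrict p) := by
      rw [← hσ]; rfl
    rw [h2]
    exact congrArg Subtype.val (LinearMap.congr_fun hr (ψ.rangeRestrict p))
  have h3 : L p = L (σ (ψ p)) := by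
    have := hker (p - σ (ψ p)) (by rw [map_sub, h1, sub_self])
    rwa [map_sub, sub_eq_zero] at this
  have h4 : ψ p = ∑ i, L p (Y i) • Pi.single i (1 : ℝ) := by
    ext j
    simp [ψ, ev, Finset.sum_apply, Pi.single_apply]
  calc L p x = L (σ (ψ p)) x := by rw [← h3]
    _ = _ := by
      rw [h4, map_sum, map_sum, Finset.sum_apply]
      simp only [map_smul, Pi.smul_apply, smul_eq_mul]

/-! ### Derivative of the determinant -/

/-- The derivative at the identity of the determinant is the trace. -/
theorem hasDerivWithinAt_det_one {n : Type*} [Fintype n] [DecidableEq n]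
    {N : ℝ → Matrix n n ℝ} {N' : Matrix n n ℝ} {S : Set ℝ} {t : ℝ}
    (h : ∀ i j, HasDerivWithinAt (fun s => N s i j) (N' i j) S t) (h1 : N t = 1) :
    HasDerivWithinAt (fun s => (N s).det) N'.trace S t := by
  simp only [Matrix.det_apply']
  have := HasDerivWithinAt.fun_sum (u := Finset.univ) fun σ (_ : σ ∈ Finset.univ) =>
    (HasDerivWithinAt.fun_finsetProd (u := Finset.univ)
      fun i _ => h (σ i) i).const_mul ((Equiv.Perm.sign σ : ℤ) : ℝ)
  refine this.congr_deriv ?_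
  rw [Finset.sum_eq_single (1 : Equiv.Perm n)]
  · simp [h1, Matrix.trace]
  · intro σ _ hσ
    rw [mul_eq_zero]
    refine Or.inr (Finset.sum_eq_zero fun i _ => ?_)
    -- A nontrivial permutation moves at least two indices, so after differentiating one factor an
    -- off-diagonal zero of the identity remains.
    obtain ⟨j, hj⟩ : ∃ j, j ≠ i ∧ σ j ≠ j := by
      by_contra! hc
      refine hσ (Equiv.ext fun j => ?_)
      by_cases hji : j = i
      · by_contra hne
        have h2 : σ j ≠ i := by rw [← hji]; exact hne
        exact hne (σ.injective (hc _ h2))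
      · exact hc j hji
    rw [Finset.prod_eq_zero (Finset.mem_erase.2 ⟨hj.1, Finset.mem_univ j⟩), zero_smul]
    rw [h1, Matrix.one_apply_ne hj.2]
  · simp

/-- Jacobi's formula for the derivative of the determinant. -/
theorem hasDerivWithinAt_det {E : Type*} [NormedAddCommGroup E] [NormedSpace ℝ E]
    [FiniteDimensional ℝ E] {J : ℝ → E →L[ℝ] E} {J' I : E →L[ℝ] E} {S : Set ℝ} {t : ℝ}
    (h : HasDerivWithinAt J J' S t) (hI : J t * I = 1) (hI' : I * J t = 1) :
    HasDerivWithinAt (fun s => (J s).det)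
      (LinearMap.trace ℝ E (J' * I : E →L[ℝ] E) * (J t).det) S t := by
  -- Multiplying by the fixed inverse `I` of `J t` reduces to the case of the identity at time `t`.
  have hN : HasDerivWithinAt (fun s => J s * I) (J' * I) S t := h.mul_const I
  let B := Module.finBasis ℝ E
  have hmat := hasDerivWithinAt_det_one (S := S) (t := t)
    (N := fun s => LinearMap.toMatrix B B (J s * I : E →L[ℝ] E))
    (N' := LinearMap.toMatrix B B (J' * I : E →L[ℝ] E)) (fun i j => by
      simp only [LinearMap.toMatrix_apply]
      have h2 : HasDerivWithinAt (fun s => (J s * I) (B j)) ((J' * I) (B j)) S t :=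
        (ContinuousLinearMap.apply ℝ E (B j)).hasFDerivAt.comp_hasDerivWithinAt t hN
      exact (LinearMap.toContinuousLinearMap (B.coord i)).hasFDerivAt.comp_hasDerivWithinAt t h2)
    (by simp only [hI]; exact LinearMap.toMatrix_one B)
  rw [LinearMap.trace_eq_matrix_trace ℝ B]
  have h3 := hmat.mul_const (J t).det
  have h4 : ∀ s, (J s).det
      = (LinearMap.toMatrix B B (J s * I : E →L[ℝ] E)).det * (J t).det := by
    intro s
    rw [LinearMap.det_toMatrix]
    have : J s = J s * I * J t := by rw [mul_assoc, hI', mul_one]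
    conv_lhs => rw [this]
    exact LinearMap.det_comp _ _
  simpa only [← h4] using h3

/-! ### Parametric integrals and the integrated energy inequality -/

/-- Continuity of a parametric integral over a compact set. -/
theorem continuousOn_integral_of_compact {X E : Type*} [TopologicalSpace X]
    [FirstCountableTopology X] [TopologicalSpace E] [MeasurableSpace E]
    [OpensMeasurableSpace E] [T2Space E] [SecondCountableTopology E] {μ : Measure E}
    [IsFiniteMeasureOnCompacts μ]
    {S : Set X} {K : Set E} (hS : IsCompact S) (hK : IsCompact K) {h : X → E → ℝ}
    (hc : ContinuousOn (fun p : X × E => h p.1 p.2) (S ×ˢ K)) :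
    ContinuousOn (fun t => ∫ y in K, h t y ∂μ) S := by
  obtain ⟨C, hC⟩ := (hS.prod hK).exists_bound_of_continuousOn hc
  refine continuousOn_of_dominated (bound := fun _ => C) (fun t ht => ?_) (fun t ht => ?_) ?_ ?_
  · refine ContinuousOn.aestronglyMeasurable ?_ hK.measurableSet
    exact hc.comp (f := fun y => (t, y)) (by fun_prop) fun y hy => ⟨ht, hy⟩
  · filter_upwards [ae_restrict_mem hK.measurableSet] with y hy using hC (t, y) ⟨ht, hy⟩
  · exact integrableOn_const hK.measure_lt_top.ne
  · filter_upwards [ae_restrict_mem hK.measurableSet] with y hy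
    exact hc.comp (f := fun t => (t, y)) (by fun_prop) fun t ht => ⟨ht, hy⟩

/-- Energy argument: a differential inequality `g' ≤ F - N / 2` with `N ≥ 0` only known to be
measurable yields integrability of `N` and the integrated inequality. -/
theorem energy_bound {T : ℝ} (hT : 0 < T) {g g' N F : ℝ → ℝ} (hg : ContinuousOn g (Icc 0 T))
    (hg' : ∀ t ∈ Ioc 0 T, HasDerivWithinAt g (g' t) (Icc 0 T) t)
    (hNm : AEMeasurable N (volume.restrict (Ioc 0 T))) (hN : ∀ t ∈ Ioc 0 T, 0 ≤ N t)
    (hF : IntegrableOn F (Ioc 0 T)) (hle : ∀ t ∈ Ioc 0 T, g' t ≤ F t - 1 / 2 * N t) :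
    IntervalIntegrable N volume 0 T ∧
      ∀ τ ∈ Icc 0 T, g τ + 1 / 2 * ∫ t in (0 : ℝ)..τ, N t ≤ g 0 + ∫ t in (0 : ℝ)..τ, F t := by
  -- Stated for integrable minorants of `N`, so that it serves first for truncations and then, once
  -- integrability is known, for `N` itself.
  have main : ∀ N₁ : ℝ → ℝ, IntegrableOn N₁ (Ioc 0 T) → (∀ t ∈ Ioc 0 T, N₁ t ≤ N t) →
      ∀ τ ∈ Icc 0 T,
        g τ + 1 / 2 * ∫ t in (0 : ℝ)..τ, N₁ t ≤ g 0 + ∫ t in (0 : ℝ)..τ, F t := by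
    intro N₁ hN₁ hN₁N τ hτ
    have hsub : Ioc 0 τ ⊆ Ioc 0 T := Ioc_subset_Ioc_right hτ.2
    have hFi : IntervalIntegrable F volume 0 τ :=
      (intervalIntegrable_iff_integrableOn_Ioc_of_le hτ.1).2 (hF.mono_set hsub)
    have hNi : IntervalIntegrable (fun t => 1 / 2 * N₁ t) volume 0 τ :=
      (intervalIntegrable_iff_integrableOn_Ioc_of_le hτ.1).2 ((hN₁.mono_set hsub).const_mul _)
    -- This one-sided fundamental theorem needs only an integrable upper bound of the right
    -- derivative; `g'` itself need not be integrable.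
    have key := intervalIntegral.sub_le_integral_of_hasDeriv_right_of_le hτ.1
      (hg.mono (Icc_subset_Icc_right hτ.2)) (g' := g') (φ := fun t => F t - 1 / 2 * N₁ t)
      (fun x hx => ?_) ?_ (fun x hx => ?_)
    · rw [intervalIntegral.integral_sub hFi hNi, intervalIntegral.integral_const_mul] at key
      linarith
    · have hx' : x ∈ Ioc 0 T := hsub ⟨hx.1, hx.2.le⟩
      refine (hg' x hx').mono_of_mem_nhdsWithin ?_
      filter_upwards [Ioo_mem_nhdsGT (hx.2.trans_le hτ.2)] with z hz
      exact ⟨hx.1.le.trans hz.1.le, hz.2.le⟩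
    · rw [integrableOn_Icc_iff_integrableOn_Ioc]
      exact (intervalIntegrable_iff_integrableOn_Ioc_of_le hτ.1).1 (hFi.sub hNi)
    · have hx' : x ∈ Ioc 0 T := hsub ⟨hx.1, hx.2.le⟩
      linarith [hle x hx', hN₁N x hx']
  have hNint : IntegrableOn N (Ioc 0 T) := by
    have hnn : ∀ᵐ t ∂(volume.restrict (Ioc 0 T)), 0 ≤ N t := by
      filter_upwards [ae_restrict_mem measurableSet_Ioc] with t ht using hN t ht
    -- The truncations of `N` at height `n` have integrals bounded independently of `n`, and Fatou's
    -- lemma passes the bound to `N`.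
    have hmin : ∀ n : ℕ, IntegrableOn (fun t => min (N t) n) (Ioc 0 T) := by
      intro n
      refine Integrable.mono' (integrable_const (n : ℝ))
        (hNm.min aemeasurable_const).aestronglyMeasurable ?_
      filter_upwards [hnn] with t ht
      rw [Real.norm_of_nonneg (le_min ht (Nat.cast_nonneg n))]
      exact min_le_right _ _
    have hbd : ∀ n : ℕ, ∫⁻ t in Ioc 0 T, ENNReal.ofReal (min (N t) n)
        ≤ ENNReal.ofReal (2 * (g 0 + (∫ t in (0 : ℝ)..T, F t) - g T)) := by
      intro n
      rw [← ofReal_integral_eq_lintegral_ofReal (hmin n)]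
      · refine ENNReal.ofReal_le_ofReal ?_
        have := main _ (hmin n) (fun t _ => min_le_left _ _) T (right_mem_Icc.2 hT.le)
        rw [intervalIntegral.integral_of_le hT.le] at this
        linarith
      · filter_upwards [hnn] with t ht using le_min ht (Nat.cast_nonneg n)
    refine ⟨hNm.aestronglyMeasurable, ?_⟩
    rw [hasFiniteIntegral_iff_ofReal hnn]
    have hlim : ∀ t, Filter.liminf (fun n : ℕ => ENNReal.ofReal (min (N t) n)) Filter.atTop
        = ENNReal.ofReal (N t) := by
      intro t
      refine Filter.Tendsto.liminf_eq (tendsto_const_nhds.congr' ?_)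
      filter_upwards [Filter.eventually_ge_atTop ⌈N t⌉₊] with n hn
      rw [min_eq_left (Nat.ceil_le.1 hn)]
    have hF := lintegral_liminf_le' (μ := volume.restrict (Ioc 0 T)) (u := Filter.atTop)
      (f := fun (n : ℕ) t => ENNReal.ofReal (min (N t) n))
      (fun n => (hNm.min aemeasurable_const).ennreal_ofReal)
    simp only [hlim] at hF
    refine (hF.trans (Filter.liminf_le_of_le ?_ fun b hb => ?_)).trans_lt
      (ENNReal.ofReal_lt_top (r := 2 * (g 0 + (∫ t in (0 : ℝ)..T, F t) - g T)))
    · isBoundedDefault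
    · obtain ⟨n, hn⟩ := hb.exists
      exact hn.trans (hbd n)
  exact ⟨(intervalIntegrable_iff_integrableOn_Ioc_of_le hT.le).2 hNint,
    main N hNint fun t _ => le_rfl⟩

/-! ### Polynomials under affine maps -/

/-- Composition of a polynomial with an affine map is a polynomial of no larger degree. -/
theorem exists_mvPolynomial_comp_affine {d k : ℕ} (p : MvPolynomial (Fin d) ℝ)
    (hp : p.totalDegree ≤ k) (A : Space d →L[ℝ] Space d) (a : Space d) :
    ∃ q : MvPolynomial (Fin d) ℝ, q.totalDegree ≤ k ∧ ∀ y : Space d,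
      MvPolynomial.eval (fun i => (A y + a) i) p = MvPolynomial.eval (fun i => y i) q := by
  let ℓ : Fin d → MvPolynomial (Fin d) ℝ := fun i =>
    ∑ j, MvPolynomial.C (A (EuclideanSpace.single j 1) i) * MvPolynomial.X j
      + MvPolynomial.C (a i)
  have hℓ : ∀ i (y : Space d), MvPolynomial.eval (fun i => y i) (ℓ i) = (A y + a) i := by
    intro i y
    have hy : y = ∑ j, y j • EuclideanSpace.single j (1 : ℝ) := by
      ext l
      simp [Finset.sum_apply, Pi.single_apply]
    conv_rhs => rw [hy]
    simp [ℓ, map_sum, mul_comm]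
  have hdeg : ∀ i, (ℓ i).totalDegree ≤ 1 := by
    intro i
    refine (MvPolynomial.totalDegree_add _ _).trans (max_le ?_ (by simp))
    refine MvPolynomial.totalDegree_finsetSum_le fun j _ => ?_
    refine (MvPolynomial.totalDegree_mul _ _).trans ?_
    simp
  refine ⟨MvPolynomial.aeval ℓ p, ?_, fun y => ?_⟩
  · rw [MvPolynomial.aeval_def, MvPolynomial.eval₂_eq]
    refine MvPolynomial.totalDegree_finsetSum_le fun m hm => ?_
    refine (MvPolynomial.totalDegree_mul _ _).trans ?_
    have h1 : (∏ i ∈ m.support, ℓ i ^ m i).totalDegree ≤ ∑ i ∈ m.support, m i := by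
      refine (MvPolynomial.totalDegree_finsetProd _ _).trans (Finset.sum_le_sum fun i _ => ?_)
      exact (MvPolynomial.totalDegree_pow _ _).trans (by nlinarith [hdeg i])
    have h2 : ∑ i ∈ m.support, m i ≤ p.totalDegree := MvPolynomial.le_totalDegree hm
    rw [MvPolynomial.algebraMap_eq, MvPolynomial.totalDegree_C]
    omega
  · rw [MvPolynomial.aeval_def, MvPolynomial.eval₂_eq, MvPolynomial.eval_eq, map_sum]
    simp [hℓ]

variable {d : ℕ} {T : ℝ}

theorem contDiff_eval_mvPolynomial (p : MvPolynomial (Fin d) ℝ) :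
    ContDiff ℝ 2 (fun y : Space d => MvPolynomial.eval (fun i => y i) p) := by
  induction p using MvPolynomial.induction_on with
  | C a => simpa using contDiff_const
  | add p q hp hq => simpa using hp.add hq
  | mul_X p i hp =>
    have hi : ContDiff ℝ 2 fun y : Space d => y i := (EuclideanSpace.proj (𝕜 := ℝ) i).contDiff
    simpa using hp.mul hi

/-! ### Affine charts of the moving cells -/

namespace MovingMesh

variable {M : MovingMesh d T} {s : Finset (Space d)} {t : ℝ}

theorem isCompact_refCell (s : Finset (Space d)) :
    IsCompact (convexHull ℝ (s : Set (Space d))) :=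
  s.finite_toSet.isCompact_convexHull ℝ

theorem refCell_subset (hs : s ∈ M.cells) :
    convexHull ℝ (s : Set (Space d)) ⊆ M.ref.space :=
  Geometry.SimplicialComplex.convexHull_subset_space ((M.mem_cells s).1 hs).1

theorem space_eq : M.ref.space = ⋃ s ∈ M.cells, convexHull ℝ (s : Set (Space d)) := by
  refine Subset.antisymm (fun x hx => ?_) (iUnion₂_subset fun s hs => refCell_subset hs)
  obtain ⟨f, hf, hx⟩ := Geometry.SimplicialComplex.mem_space_iff.1 hx
  obtain ⟨s, hs, hfs⟩ := M.pure f hf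
  exact mem_iUnion₂.2 ⟨s, hs, convexHull_mono (Finset.coe_subset.2 hfs) hx⟩

theorem domain_eq (M : MovingMesh d T) (t : ℝ) : M.domain t = ⋃ s ∈ M.cells, M.cell s t := by
  simp only [domain, space_eq, image_iUnion₂, cell]

theorem cell_subset_domain (hs : s ∈ M.cells) (t : ℝ) : M.cell s t ⊆ M.domain t :=
  image_mono (refCell_subset hs)

theorem aleInv_ale (ht : t ∈ Icc 0 T) {Y : Space d} (hY : Y ∈ M.ref.space) :
    M.aleInv t (M.ale t Y) = Y :=
  (M.ale_injOn t ht).leftInvOn_invFunOn hY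

theorem affineSpan_cell (hs : s ∈ M.cells) :
    affineSpan ℝ (range ((↑) : s → Space d)) = ⊤ := by
  obtain ⟨h1, h2⟩ := (M.mem_cells s).1 hs
  rw [(M.ref.indep h1).affineSpan_eq_top_iff_card_eq_finrank_add_one]
  simpa using h2

/-- The affine parametrization of a moving cell by its reference cell, together with its time
derivative. -/
structure CellChart (M : MovingMesh d T) (s : Finset (Space d)) where
  J : ℝ → Space d →L[ℝ] Space d
  J' : ℝ → Space d →L[ℝ] Space d
  a : ℝ → Space d
  a' : ℝ → Space d
  mem_cells : s ∈ M.cells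
  hasDeriv_J : ∀ t ∈ Icc 0 T, HasDerivWithinAt J (J' t) (Icc 0 T) t
  hasDeriv_a : ∀ t ∈ Icc 0 T, HasDerivWithinAt a (a' t) (Icc 0 T) t
  continuousOn_J' : ContinuousOn J' (Icc 0 T)
  continuousOn_a' : ContinuousOn a' (Icc 0 T)
  ale_eq : ∀ t ∈ Icc 0 T, ∀ Y ∈ convexHull ℝ (s : Set (Space d)), M.ale t Y = J t Y + a t

/-- An affine map is the combination of its vertex values with barycentric coordinates as weights.
The weights do not depend on time, so the linear part and the translation inherit the C¹ regularity
of the finitely many vertex trajectories. -/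
theorem nonempty_cellChart (hT : 0 < T) (hs : s ∈ M.cells) : Nonempty (M.CellChart s) := by
  obtain ⟨h1, h2⟩ := (M.mem_cells s).1 hs
  let b : AffineBasis s ℝ (Space d) := ⟨((↑) : s → Space d), M.ref.indep h1, affineSpan_cell hs⟩
  have hb : ∀ v, b v = v := fun v => rfl
  let ℓ : s → Space d →L[ℝ] ℝ := fun v => LinearMap.toContinuousLinearMap (b.coord v).linear
  have hℓ : ∀ v Y, b.coord v Y = ℓ v Y + b.coord v 0 := by
    intro v Y
    have := (b.coord v).map_vadd 0 Y
    simpa [ℓ] using this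
  have hvs : ∀ v : s, (v : Space d) ∈ M.ref.space := fun v =>
    refCell_subset hs (subset_convexHull ℝ _ v.2)
  have hud : UniqueDiffOn ℝ (Icc 0 T) := uniqueDiffOn_Icc hT
  have hder : ∀ v : s, ∀ t ∈ Icc 0 T, HasDerivWithinAt (fun τ => M.ale τ v)
      (derivWithin (fun τ => M.ale τ v) (Icc 0 T) t) (Icc 0 T) t := fun v t ht =>
    ((M.ale_contDiffOn v (hvs v)).differentiableOn (by simp) t ht).hasDerivWithinAt
  have hcont : ∀ v : s, ContinuousOn (fun t => derivWithin (fun τ => M.ale τ v) (Icc 0 T) t)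
      (Icc 0 T) := fun v =>
    (M.ale_contDiffOn v (hvs v)).continuousOn_derivWithin hud le_rfl
  refine ⟨{
    J := fun t => ∑ v : s, (ℓ v).smulRight (M.ale t v)
    J' := fun t => ∑ v : s, (ℓ v).smulRight (derivWithin (fun τ => M.ale τ v) (Icc 0 T) t)
    a := fun t => ∑ v : s, b.coord v 0 • M.ale t v
    a' := fun t => ∑ v : s, b.coord v 0 • derivWithin (fun τ => M.ale τ v) (Icc 0 T) t
    mem_cells := hs
    hasDeriv_J := fun t ht => HasDerivWithinAt.fun_sum fun v _ => ?_
    hasDeriv_a := fun t ht => HasDerivWithinAt.fun_sum fun v _ => (hder v t ht).fun_const_smul _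
    continuousOn_J' := continuousOn_finsetSum _ fun v _ => ?_
    continuousOn_a' := continuousOn_finsetSum _ fun v _ => (hcont v).fun_const_smul _
    ale_eq := fun t ht Y hY => ?_ }⟩
  · exact (ContinuousLinearMap.smulRightL ℝ (Space d) (Space d) (ℓ v)).hasFDerivAt
      |>.comp_hasDerivWithinAt t (hder v t ht)
  · exact (ContinuousLinearMap.smulRightL ℝ (Space d) (Space d) (ℓ v)).continuous.comp_continuousOn
      (hcont v)
  · obtain ⟨g, hg⟩ := M.ale_affine t ht s hs
    have h3 : ∀ v : s, M.ale t v = g v := fun v => hg (subset_convexHull ℝ _ v.2)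
    have h4 : g Y = ∑ v : s, b.coord v Y • g v := by
      conv_lhs => rw [← b.affineCombination_coord_eq_self Y]
      rw [Finset.map_affineCombination _ _ _ (b.sum_coord_apply_eq_one Y),
        Finset.affineCombination_eq_linear_combination _ _ _ (b.sum_coord_apply_eq_one Y)]
      rfl
    rw [hg hY, h4]
    simp only [h3, sum_apply, ContinuousLinearMap.smulRight_apply,
      ← Finset.sum_add_distrib, ← add_smul, ← hℓ]

theorem refCell_interior_nonempty (hs : s ∈ M.cells) :
    (interior (convexHull ℝ (s : Set (Space d)))).Nonempty := by
  rw [interior_convexHull_nonempty_iff_affineSpan_eq_top]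
  simpa using affineSpan_cell hs

theorem volume_frontier_refCell (s : Finset (Space d)) :
    volume (frontier (convexHull ℝ (s : Set (Space d)))) = 0 :=
  (convex_convexHull ℝ _).addHaar_frontier volume

theorem ae_mem_interior_refCell (s : Finset (Space d)) :
    ∀ᵐ Y ∂(volume.restrict (convexHull ℝ (s : Set (Space d)))),
      Y ∈ interior (convexHull ℝ (s : Set (Space d))) := by
  rw [ae_restrict_iff' (isCompact_refCell s).measurableSet]
  filter_upwards [measure_eq_zero_iff_ae_notMem.1 (volume_frontier_refCell s)] with Y h1 h2
  by_contra h3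
  exact h1 ⟨subset_closure h2, h3⟩

namespace CellChart

variable (C : M.CellChart s)

/-- The affine map extending the ALE map from the reference cell. -/
def map (t : ℝ) (Y : Space d) : Space d := C.J t Y + C.a t

/-- The inverse of the linear part of the chart. -/
noncomputable def I (t : ℝ) : Space d →L[ℝ] Space d := Ring.inverse (C.J t)

/-- The reference cell has interior, so moving from an interior point a little along a kernel vector
stays in the cell. Both points have the same image, and injectivity of the ALE map forces the vector
to vanish. -/
theorem injective_J (ht : t ∈ Icc 0 T) : Function.Injective (C.J t) := by
  rw [injective_iff_map_eq_zero]
  intro v hv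
  obtain ⟨Y, hY⟩ := refCell_interior_nonempty C.mem_cells
  have hlim : Filter.Tendsto (fun r : ℝ => Y + r • v) (nhdsWithin 0 (Ioi 0)) (nhds Y) := by
    have : Continuous fun r : ℝ => Y + r • v := by fun_prop
    simpa using (this.tendsto 0).mono_left nhdsWithin_le_nhds
  obtain ⟨r, hr, hr0⟩ := ((hlim.eventually (mem_interior_iff_mem_nhds.1 hY)).and
    self_mem_nhdsWithin).exists
  have hY' := interior_subset hY
  have h1 : M.ale t (Y + r • v) = M.ale t Y := by
    rw [C.ale_eq t ht _ hr, C.ale_eq t ht _ hY', map_add, map_smul, hv, smul_zero, add_zero]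
  have h2 := M.ale_injOn t ht (refCell_subset C.mem_cells hr) (refCell_subset C.mem_cells hY') h1
  have h3 : r • v = 0 := by simpa using h2
  exact (smul_eq_zero.1 h3).resolve_left (ne_of_gt hr0)

theorem isUnit_J (ht : t ∈ Icc 0 T) : IsUnit (C.J t) := by
  let e := (LinearEquiv.ofInjectiveEndo (C.J t : Space d →ₗ[ℝ] Space d)
    (C.injective_J ht)).toContinuousLinearEquiv
  have : (e : Space d →L[ℝ] Space d) = C.J t := by
    ext1 x; rfl
  rw [← this]
  exact (ContinuousLinearEquiv.toUnit e).isUnit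

theorem J_mul_I (ht : t ∈ Icc 0 T) : C.J t * C.I t = 1 :=
  Ring.mul_inverse_cancel _ (C.isUnit_J ht)

theorem I_mul_J (ht : t ∈ Icc 0 T) : C.I t * C.J t = 1 :=
  Ring.inverse_mul_cancel _ (C.isUnit_J ht)

theorem J_I_apply (ht : t ∈ Icc 0 T) (x : Space d) : C.J t (C.I t x) = x :=
  congrArg (fun L : Space d →L[ℝ] Space d => L x) (C.J_mul_I ht)

theorem I_J_apply (ht : t ∈ Icc 0 T) (x : Space d) : C.I t (C.J t x) = x :=
  congrArg (fun L : Space d →L[ℝ] Space d => L x) (C.I_mul_J ht)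

theorem continuousOn_J : ContinuousOn C.J (Icc 0 T) := fun t ht =>
  (C.hasDeriv_J t ht).continuousWithinAt

theorem continuousOn_a : ContinuousOn C.a (Icc 0 T) := fun t ht =>
  (C.hasDeriv_a t ht).continuousWithinAt

theorem continuousOn_I : ContinuousOn C.I (Icc 0 T) := fun t ht => by
  have h := NormedRing.inverse_continuousAt (C.isUnit_J ht).unit
  rw [IsUnit.unit_spec] at h
  exact h.comp_continuousWithinAt (C.continuousOn_J t ht)

theorem det_ne_zero (ht : t ∈ Icc 0 T) : (C.J t).det ≠ 0 := by
  intro h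
  have h1 : (C.J t * C.I t : Space d →L[ℝ] Space d).det = (C.J t).det * (C.I t).det :=
    LinearMap.det_comp _ _
  have h2 : (1 : Space d →L[ℝ] Space d).det = 1 := LinearMap.det_id
  rw [C.J_mul_I ht, h2, h, zero_mul] at h1
  exact one_ne_zero h1

theorem continuousOn_det : ContinuousOn (fun t => (C.J t).det) (Icc 0 T) :=
  ContinuousLinearMap.continuous_det.comp_continuousOn C.continuousOn_J

/-- The chart as a homeomorphism of the space. -/
noncomputable def homeo (ht : t ∈ Icc 0 T) : Space d ≃ₜ Space d where
  toFun := C.map t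
  invFun x := C.I t (x - C.a t)
  left_inv Y := by simp [map, C.I_J_apply ht]
  right_inv x := by simp [map, C.J_I_apply ht]
  continuous_toFun := by unfold map; fun_prop
  continuous_invFun := by fun_prop

theorem continuous_map (t : ℝ) : Continuous (C.map t) := by unfold map; fun_prop

theorem continuousOn_map :
    ContinuousOn (fun p : ℝ × Space d => C.map p.1 p.2) (Icc 0 T ×ˢ univ) := by
  refine ContinuousOn.add ?_ (C.continuousOn_a.comp continuousOn_fst fun p hp => hp.1)
  exact (C.continuousOn_J.comp continuousOn_fst fun p hp => hp.1).clm_apply continuousOn_snd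

theorem cell_eq (ht : t ∈ Icc 0 T) :
    M.cell s t = C.map t '' convexHull ℝ (s : Set (Space d)) :=
  image_congr fun Y hY => C.ale_eq t ht Y hY

theorem isCompact_cell (C : M.CellChart s) (ht : t ∈ Icc 0 T) : IsCompact (M.cell s t) := by
  rw [C.cell_eq ht]
  exact (isCompact_refCell s).image (C.continuous_map t)

theorem convex_cell (C : M.CellChart s) (ht : t ∈ Icc 0 T) : Convex ℝ (M.cell s t) := by
  rw [C.cell_eq ht]
  have : C.map t '' convexHull ℝ (s : Set (Space d))
      = (fun x => x + C.a t) '' ((C.J t : Space d →ₗ[ℝ] Space d) '' convexHull ℝ (s : Set (Space d))) := by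
    rw [image_image]; rfl
  rw [this]
  have h := ((convex_convexHull ℝ (s : Set (Space d))).linear_image
    (C.J t : Space d →ₗ[ℝ] Space d)).translate (C.a t)
  simpa only [add_comm] using h

theorem interior_cell (ht : t ∈ Icc 0 T) :
    interior (M.cell s t) = C.map t '' interior (convexHull ℝ (s : Set (Space d))) := by
  rw [C.cell_eq ht]
  exact ((C.homeo ht).image_interior _).symm

theorem ae_mem_interior_cell (C : M.CellChart s) (ht : t ∈ Icc 0 T) :
    ∀ᵐ x ∂(volume.restrict (M.cell s t)), x ∈ interior (M.cell s t) := by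
  rw [ae_restrict_iff' (C.isCompact_cell ht).measurableSet]
  filter_upwards [measure_eq_zero_iff_ae_notMem.1
    ((C.convex_cell ht).addHaar_frontier volume)] with x h1 h2
  by_contra h3
  exact h1 ⟨subset_closure h2, h3⟩

theorem integral_cell (ht : t ∈ Icc 0 T) (g : Space d → ℝ) :
    ∫ x in M.cell s t, g x
      = |(C.J t).det| * ∫ Y in convexHull ℝ (s : Set (Space d)), g (C.map t Y) := by
  rw [C.cell_eq ht, integral_image_eq_integral_abs_det_fderiv_smul volume
    (isCompact_refCell s).measurableSet (f' := fun _ => C.J t)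
    (f := C.map t) (fun x _ => ((C.J t).hasFDerivAt.add_const (C.a t)).hasFDerivWithinAt)
    ((C.homeo ht).injective.injOn)]
  simp only [smul_eq_mul]
  rw [integral_const_mul]

/-- Gradients and divergences are controlled only in the open cell, where the cellwise formula holds
on a neighbourhood. The boundary of a convex set is null, so this suffices. -/
theorem integral_cell_of_eq (ht : t ∈ Icc 0 T) {g h : Space d → ℝ}
    (hgh : ∀ Y ∈ interior (convexHull ℝ (s : Set (Space d))), g (C.map t Y) = h Y) :
    ∫ x in M.cell s t, g x
      = |(C.J t).det| * ∫ Y in convexHull ℝ (s : Set (Space d)), h Y := by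
  rw [C.integral_cell ht]
  congr 1
  refine integral_congr_ae ?_
  filter_upwards [ae_mem_interior_refCell s] with Y hY using hgh Y hY

theorem hasDeriv_ale (ht : t ∈ Icc 0 T) {Y : Space d}
    (hY : Y ∈ convexHull ℝ (s : Set (Space d))) :
    HasDerivWithinAt (fun τ => M.ale τ Y) (C.J' t Y + C.a' t) (Icc 0 T) t := by
  have h1 : HasDerivWithinAt (fun τ => C.map τ Y) (C.J' t Y + C.a' t) (Icc 0 T) t :=
    ((ContinuousLinearMap.apply ℝ (Space d) Y).hasFDerivAt.comp_hasDerivWithinAt t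
      (C.hasDeriv_J t ht)).add (C.hasDeriv_a t ht)
  exact h1.congr (fun τ hτ => C.ale_eq τ hτ Y hY) (C.ale_eq t ht Y hY)

theorem aleInv_map (ht : t ∈ Icc 0 T) {Y : Space d}
    (hY : Y ∈ convexHull ℝ (s : Set (Space d))) : M.aleInv t (C.map t Y) = Y := by
  have := M.aleInv_ale ht (refCell_subset C.mem_cells hY)
  rwa [C.ale_eq t ht Y hY] at this

theorem velocity_map (hT : 0 < T) (ht : t ∈ Icc 0 T) {Y : Space d}
    (hY : Y ∈ convexHull ℝ (s : Set (Space d))) :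
    M.velocity t (C.map t Y) = C.J' t Y + C.a' t := by
  rw [velocity, C.aleInv_map ht hY]
  exact (C.hasDeriv_ale ht hY).derivWithin (uniqueDiffOn_Icc hT t ht)

/-- The mesh velocity is affine on every cell. -/
theorem velocity_eq (hT : 0 < T) (ht : t ∈ Icc 0 T) {x : Space d} (hx : x ∈ M.cell s t) :
    M.velocity t x = (C.J' t * C.I t : Space d →L[ℝ] Space d) (x - C.a t) + C.a' t := by
  rw [C.cell_eq ht] at hx
  obtain ⟨Y, hY, rfl⟩ := hx
  rw [C.velocity_map hT ht hY]
  simp [map, C.I_J_apply ht]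

end CellChart

/-! ### Almost disjoint cells and cellwise integration -/

/-- By conformity the intersection lies in the hull of the common vertices. Both cells have `d + 1`
vertices, so `s` has one that is not shared; by affine independence the common vertices span a
proper affine subspace, which is null. -/
theorem volume_refCell_inter {s' : Finset (Space d)} (hs : s ∈ M.cells) (hs' : s' ∈ M.cells)
    (hne : s ≠ s') : volume (convexHull ℝ (s : Set (Space d)) ∩ convexHull ℝ (s' : Set (Space d)))
      = 0 := by
  obtain ⟨h1, h2⟩ := (M.mem_cells s).1 hs
  obtain ⟨h1', h2'⟩ := (M.mem_cells s').1 hs'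
  refine measure_mono_null (M.ref.inter_subset_convexHull h1 h1') ?_
  obtain ⟨v, hv, hv'⟩ : ∃ v ∈ s, v ∉ s' := by
    by_contra! hc
    exact hne (Finset.eq_of_subset_of_card_le hc (h2'.trans h2.symm).le)
  refine measure_mono_null (convexHull_subset_affineSpan _)
    (Measure.addHaar_affineSubspace volume _ fun htop => ?_)
  have h3 := (M.ref.indep h1).notMem_affineSpan_sdiff ⟨v, hv⟩ univ
  refine h3 (affineSpan_mono ℝ (s₁ := (s ∩ s' : Set (Space d))) ?_ (htop ▸ AffineSubspace.mem_top ..))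
  rintro x ⟨hx, hx'⟩
  refine ⟨⟨x, hx⟩, ⟨mem_univ _, ?_⟩, rfl⟩
  intro h
  obtain rfl : x = v := congrArg Subtype.val h
  exact hv' hx'

theorem aedisjoint_cell (hT : 0 < T) {s' : Finset (Space d)} (hs : s ∈ M.cells)
    (hs' : s' ∈ M.cells) (hne : s ≠ s') (ht : t ∈ Icc 0 T) :
    AEDisjoint volume (M.cell s t) (M.cell s' t) := by
  obtain ⟨C⟩ := nonempty_cellChart hT hs
  have h1 : M.cell s t ∩ M.cell s' t = C.map t ''
      (convexHull ℝ (s : Set (Space d)) ∩ convexHull ℝ (s' : Set (Space d))) := by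
    rw [cell, cell, ← (M.ale_injOn t ht).image_inter (refCell_subset hs) (refCell_subset hs')]
    exact image_congr fun Y hY => C.ale_eq t ht Y hY.1
  rw [AEDisjoint, h1]
  refine addHaar_image_eq_zero_of_differentiableOn_of_addHaar_eq_zero volume ?_
    (volume_refCell_inter hs hs' hne)
  exact ((C.J t).differentiable.add_const (C.a t)).differentiableOn

theorem restrict_domain (hT : 0 < T) (ht : t ∈ Icc 0 T) :
    volume.restrict (M.domain t) = ∑ s ∈ M.cells, volume.restrict (M.cell s t) := by
  have h1 : M.domain t = ⋃ s : M.cells, M.cell s t := by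
    rw [domain_eq, iUnion_subtype]
  rw [h1, Measure.restrict_iUnion_ae]
  · exact Measure.sum_coe_finset M.cells fun s => volume.restrict (M.cell s t)
  · intro s s' hne
    exact aedisjoint_cell hT s.2 s'.2 (fun h => hne (Subtype.ext h)) ht
  · intro s
    obtain ⟨C⟩ := nonempty_cellChart hT s.2
    exact (C.isCompact_cell ht).measurableSet.nullMeasurableSet

theorem ae_domain_iff (hT : 0 < T) (ht : t ∈ Icc 0 T) {P : Space d → Prop} :
    (∀ᵐ x ∂(volume.restrict (M.domain t)), P x) ↔
      ∀ s ∈ M.cells, ∀ᵐ x ∂(volume.restrict (M.cell s t)), P x := by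
  rw [restrict_domain hT ht, ae_finsetSum_measure_iff]

theorem integrableOn_domain_iff (hT : 0 < T) (ht : t ∈ Icc 0 T) {g : Space d → ℝ} :
    IntegrableOn g (M.domain t) ↔ ∀ s ∈ M.cells, IntegrableOn g (M.cell s t) := by
  rw [IntegrableOn, restrict_domain hT ht, integrable_finsetSum_measure]
  rfl

theorem integral_domain (hT : 0 < T) (ht : t ∈ Icc 0 T) {g : Space d → ℝ}
    (hg : ∀ s ∈ M.cells, IntegrableOn g (M.cell s t)) :
    ∫ x in M.domain t, g x = ∑ s ∈ M.cells, ∫ x in M.cell s t, g x := by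
  rw [restrict_domain hT ht, integral_finsetSum_measure hg]

theorem isCompact_domain (hT : 0 < T) (ht : t ∈ Icc 0 T) : IsCompact (M.domain t) := by
  rw [domain_eq]
  refine M.cells.isCompact_biUnion fun s hs => ?_
  obtain ⟨C⟩ := nonempty_cellChart hT hs
  exact C.isCompact_cell ht

end MovingMesh

/-! ### Differential operators in chart coordinates -/

theorem contDiff_gradient_continuous {f : Space d → ℝ} (hf : ContDiff ℝ 2 f) :
    Continuous (gradient f) :=
  (InnerProductSpace.toDual ℝ (Space d)).symm.continuous.comp
    (hf.continuous_fderiv (by simp))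

theorem contDiff_laplacian_continuous {f : Space d → ℝ} (hf : ContDiff ℝ 2 f) :
    Continuous (Laplacian.laplacian f) := by
  rw [InnerProductSpace.laplacian_eq_iteratedFDeriv_stdOrthonormalBasis]
  refine continuous_finsetSum _ fun i _ => ?_
  exact (hf.continuous_iteratedFDeriv le_rfl).eval_const _

theorem hasGradientAt_comp_affine {f : Space d → ℝ} {g x a : Space d} {L : Space d →L[ℝ] Space d}
    (hf : HasGradientAt f g (L (x - a))) :
    HasGradientAt (fun z => f (L (z - a))) (ContinuousLinearMap.adjoint L g) x := by
  rw [hasGradientAt_iff_hasFDerivAt] at hf ⊢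
  have h1 : HasFDerivAt (fun z => L (z - a)) L x := by
    exact L.hasFDerivAt.comp x ((hasFDerivAt_id x).sub_const a)
  refine (hf.comp x h1).congr_fderiv ?_
  ext v
  simp [ContinuousLinearMap.adjoint_inner_left]

theorem divergence_eq_trace {b : Space d → Space d} {x : Space d} {L : Space d →L[ℝ] Space d}
    (h : HasFDerivAt b L x) : divergence b x = LinearMap.trace ℝ (Space d) L := by
  rw [divergence, h.fderiv, LinearMap.trace_eq_sum_inner _ (EuclideanSpace.basisFun (Fin d) ℝ)]
  simp [EuclideanSpace.inner_single_left]

namespace MovingMesh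

variable {M : MovingMesh d T} {s : Finset (Space d)} {t : ℝ}

namespace CellChart

variable (C : M.CellChart s)

/-- The chart moves all time dependence into the integrand and the Jacobian, leaving an integral
over a fixed compact cell. -/
theorem continuousOn_integral_cell {g h : ℝ → Space d → ℝ}
    (hh : ContinuousOn (fun p : ℝ × Space d => h p.1 p.2)
      (Icc 0 T ×ˢ convexHull ℝ (s : Set (Space d))))
    (hgh : ∀ t ∈ Icc 0 T, ∀ Y ∈ interior (convexHull ℝ (s : Set (Space d))),
      g t (C.map t Y) = h t Y) :
    ContinuousOn (fun t => ∫ x in M.cell s t, g t x) (Icc 0 T) := by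
  have h1 := C.continuousOn_det.abs.mul
    (continuousOn_integral_of_compact (μ := volume) isCompact_Icc (isCompact_refCell s) hh)
  exact h1.congr fun t ht => C.integral_cell_of_eq ht (hgh t ht)

theorem hasFDerivAt_velocity (hT : 0 < T) (ht : t ∈ Icc 0 T) {x : Space d}
    (hx : x ∈ interior (M.cell s t)) :
    HasFDerivAt (M.velocity t) (C.J' t * C.I t) x := by
  have h1 : HasFDerivAt (fun x => (C.J' t * C.I t : Space d →L[ℝ] Space d) (x - C.a t) + C.a' t)
      (C.J' t * C.I t) x :=
    ((C.J' t * C.I t).hasFDerivAt.comp x ((hasFDerivAt_id x).sub_const _)).add_const _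
  refine h1.congr_of_eventuallyEq ?_
  filter_upwards [mem_interior_iff_mem_nhds.1 hx] with z hz using C.velocity_eq hT ht hz

theorem continuousOn_velocity (C : M.CellChart s) (hT : 0 < T) (ht : t ∈ Icc 0 T) :
    ContinuousOn (M.velocity t) (M.cell s t) := by
  have : Continuous fun x => (C.J' t * C.I t : Space d →L[ℝ] Space d) (x - C.a t) + C.a' t := by
    fun_prop
  exact this.continuousOn.congr fun x hx => C.velocity_eq hT ht hx

/-- For elementwise derivatives: across cell faces a finite element function may fail to be
differentiable, so `g` need agree with a continuous function only inside the cell. -/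
theorem memLp_top_cell (C : M.CellChart s) (ht : t ∈ Icc 0 T) {F : Type*} [NormedAddCommGroup F]
    [SecondCountableTopology F] {g h : Space d → F}
    (hh : ContinuousOn h (M.cell s t)) (hgh : ∀ x ∈ interior (M.cell s t), g x = h x) :
    MemLp g ⊤ (volume.restrict (M.cell s t)) := by
  obtain ⟨B, hB⟩ := (C.isCompact_cell ht).exists_bound_of_continuousOn hh
  have hm := (C.isCompact_cell ht).measurableSet
  have h1 : MemLp h ⊤ (volume.restrict (M.cell s t)) := by
    refine memLp_top_of_bound (hh.aestronglyMeasurable hm) B ?_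
    filter_upwards [ae_restrict_mem hm] with x hx using hB x hx
  refine h1.ae_eq ?_
  filter_upwards [C.ae_mem_interior_cell ht] with x hx using (hgh x hx).symm

end CellChart

/-! ### Nodal form of the discrete solution and Reynolds' theorem -/

/-- Representation of a moving finite element function on a cell by finitely many nodal values
that depend on time and fixed shape functions on the reference cell. -/
structure NodalForm (M : MovingMesh d T) (u : ℝ → Space d → ℝ) (s : Finset (Space d)) where
  n : ℕ
  c : Fin n → ℝ → ℝ
  c' : Fin n → ℝ → ℝ
  φ : Fin n → Space d → ℝ
  contDiff_φ : ∀ i, ContDiff ℝ 2 (φ i)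
  continuousOn_c : ∀ i, ContinuousOn (c i) (Icc 0 T)
  hasDeriv_c : ∀ i, ∀ t ∈ Ioc 0 T, HasDerivWithinAt (c i) (c' i t) (Icc 0 T) t
  eq : ∀ t ∈ Icc 0 T, ∀ Y ∈ convexHull ℝ (s : Set (Space d)),
    u t (M.ale t Y) = ∑ i, c i t * φ i Y

/-- Pulled back by the affine chart, `u t` is a polynomial of degree at most `k` on a fixed cell.
Its coefficients in the nodal representation are values at fixed material points, where continuity
and differentiability in time are given. -/
theorem nonempty_nodalForm {k : ℕ} {D : Data d} {u₀ : Space d → ℝ} {u : ℝ → Space d → ℝ}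
    (hu : IsSemidiscreteSolution M k D u₀ u) (C : M.CellChart s) : Nonempty (M.NodalForm u s) := by
  let L : MvPolynomial.restrictTotalDegree (Fin d) ℝ k →ₗ[ℝ]
      (convexHull ℝ (s : Set (Space d))) → ℝ :=
    { toFun := fun p Y => MvPolynomial.eval (fun i => (Y : Space d) i) (p : MvPolynomial (Fin d) ℝ)
      map_add' := fun p q => by ext Y; simp
      map_smul' := fun r p => by ext Y; simp [MvPolynomial.smul_eval] }
  obtain ⟨n, Y, φ, hφ⟩ := exists_nodal_representation L
  have hY : ∀ i, (Y i : Space d) ∈ M.ref.space := fun i => refCell_subset C.mem_cells (Y i).2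
  refine ⟨{
    n := n
    c := fun i t => u t (M.ale t (Y i))
    c' := fun i t => derivWithin (fun τ => u τ (M.ale τ (Y i))) (Icc 0 T) t
    φ := fun i y => MvPolynomial.eval (fun j => y j) (φ i : MvPolynomial (Fin d) ℝ)
    contDiff_φ := fun i => contDiff_eval_mvPolynomial _
    continuousOn_c := fun i => hu.continuousOn _ (hY i)
    hasDeriv_c := fun i t ht => (hu.differentiableOn _ (hY i) t ht).hasDerivWithinAt
    eq := fun t ht y hy => ?_ }⟩
  obtain ⟨p, hp, hpu⟩ := (hu.isFE t ht).polynomial s C.mem_cells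
  obtain ⟨q, hq, hpq⟩ := exists_mvPolynomial_comp_affine p hp (C.J t) (C.a t)
  have h1 : ∀ z ∈ convexHull ℝ (s : Set (Space d)),
      u t (M.ale t z) = MvPolynomial.eval (fun i => z i) q := by
    intro z hz
    rw [hpu _ (mem_image_of_mem _ hz), C.ale_eq t ht z hz]
    exact hpq z
  have h2 := hφ ⟨q, (MvPolynomial.mem_restrictTotalDegree _ _ _).2 hq⟩ ⟨y, hy⟩
  simp only [L, LinearMap.coe_mk, AddHom.coe_mk] at h2
  rw [h1 y hy, h2]
  exact Finset.sum_congr rfl fun i _ => by rw [h1 _ (Y i).2]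

namespace NodalForm

variable {u : ℝ → Space d → ℝ} (N : M.NodalForm u s) (C : M.CellChart s)

/-- The gradient pulled back to the reference cell. -/
noncomputable def grad (t : ℝ) (Y : Space d) : Space d :=
  ContinuousLinearMap.adjoint (C.I t) (∑ i, N.c i t • gradient (N.φ i) Y)

theorem map_eq (ht : t ∈ Icc 0 T) {Y : Space d} (hY : Y ∈ convexHull ℝ (s : Set (Space d))) :
    u t (C.map t Y) = ∑ i, N.c i t * N.φ i Y := by
  rw [← N.eq t ht Y hY, C.ale_eq t ht Y hY]; rfl

theorem cell_eq (ht : t ∈ Icc 0 T) {x : Space d} (hx : x ∈ M.cell s t) :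
    u t x = ∑ i, N.c i t * N.φ i (C.I t (x - C.a t)) := by
  rw [C.cell_eq ht] at hx
  obtain ⟨Y, hY, rfl⟩ := hx
  rw [N.map_eq C ht hY]
  simp [CellChart.map, C.I_J_apply ht]

theorem gradient_map (ht : t ∈ Icc 0 T) {Y : Space d}
    (hY : Y ∈ interior (convexHull ℝ (s : Set (Space d)))) :
    gradient (u t) (C.map t Y) = N.grad C t Y := by
  have hx : C.map t Y ∈ interior (M.cell s t) := by
    rw [C.interior_cell ht]; exact mem_image_of_mem _ hY
  have hY' : C.I t (C.map t Y - C.a t) = Y := by simp [CellChart.map, C.I_J_apply ht]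
  refine HasGradientAt.gradient ?_
  have h1 : HasGradientAt (fun y => ∑ i, N.c i t * N.φ i y) (∑ i, N.c i t • gradient (N.φ i) Y)
      (C.I t (C.map t Y - C.a t)) := by
    rw [hY', hasGradientAt_iff_hasFDerivAt, map_sum]
    refine HasFDerivAt.fun_sum fun i _ => ?_
    rw [map_smul]
    refine HasFDerivAt.const_mul ?_ _
    have := ((N.contDiff_φ i).differentiable (by simp) Y).hasGradientAt
    exact hasGradientAt_iff_hasFDerivAt.1 this
  refine (hasGradientAt_comp_affine h1).congr_of_eventuallyEq ?_
  filter_upwards [mem_interior_iff_mem_nhds.1 hx] with z hz using N.cell_eq C ht hz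

theorem aleDeriv_map (hT : 0 < T) (ht : t ∈ Ioc 0 T) {Y : Space d}
    (hY : Y ∈ convexHull ℝ (s : Set (Space d))) :
    M.aleDeriv u t (C.map t Y) = ∑ i, N.c' i t * N.φ i Y := by
  have ht' := Ioc_subset_Icc_self ht
  rw [aleDeriv, C.aleInv_map ht' hY]
  have h1 : HasDerivWithinAt (fun τ => ∑ i, N.c i τ * N.φ i Y) (∑ i, N.c' i t * N.φ i Y)
      (Icc 0 T) t :=
    HasDerivWithinAt.fun_sum fun i _ => (N.hasDeriv_c i t ht).mul_const _
  exact (h1.congr (fun τ hτ => N.eq τ hτ Y hY) (N.eq t ht' Y hY)).derivWithin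
    (uniqueDiffOn_Icc hT t ht')

theorem aleDeriv_eq (hT : 0 < T) (ht : t ∈ Ioc 0 T) {x : Space d} (hx : x ∈ M.cell s t) :
    M.aleDeriv u t x = ∑ i, N.c' i t * N.φ i (C.I t (x - C.a t)) := by
  have ht' := Ioc_subset_Icc_self ht
  rw [C.cell_eq ht'] at hx
  obtain ⟨Y, hY, rfl⟩ := hx
  rw [N.aleDeriv_map C hT ht hY]
  simp [CellChart.map, C.I_J_apply ht']

theorem continuousOn_value :
    ContinuousOn (fun p : ℝ × Space d => ∑ i, N.c i p.1 * N.φ i p.2) (Icc 0 T ×ˢ univ) := by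
  refine continuousOn_finsetSum _ fun i _ => ContinuousOn.mul ?_ ?_
  · exact (N.continuousOn_c i).comp continuousOn_fst fun p hp => hp.1
  · exact ((N.contDiff_φ i).continuous.comp continuous_snd).continuousOn

theorem continuousOn_grad :
    ContinuousOn (fun p : ℝ × Space d => N.grad C p.1 p.2) (Icc 0 T ×ˢ univ) := by
  refine ContinuousOn.clm_apply ?_ (continuousOn_finsetSum _ fun i _ => ContinuousOn.fun_smul ?_ ?_)
  · exact (ContinuousLinearMap.adjoint (𝕜 := ℝ) (E := Space d) (F := Space d)).continuous
      |>.comp_continuousOn (C.continuousOn_I.comp continuousOn_fst fun p hp => hp.1)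
  · exact (N.continuousOn_c i).comp continuousOn_fst fun p hp => hp.1
  · exact ((contDiff_gradient_continuous (N.contDiff_φ i)).comp continuous_snd).continuousOn

theorem continuousOn_normSq_cell (N : M.NodalForm u s) (C : M.CellChart s) :
    ContinuousOn (fun t => normSq (M.cell s t) (u t)) (Icc 0 T) := by
  refine C.continuousOn_integral_cell (h := fun t Y => ‖∑ i, N.c i t * N.φ i Y‖ ^ 2) ?_ ?_
  · exact ((N.continuousOn_value.mono (prod_mono_right (subset_univ _))).norm.pow 2)
  · intro t ht Y hY
    rw [N.map_eq C ht (interior_subset hY)]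

theorem continuousOn_normSq_gradient_cell (N : M.NodalForm u s) (C : M.CellChart s) :
    ContinuousOn (fun t => normSq (M.cell s t) (gradient (u t))) (Icc 0 T) := by
  refine C.continuousOn_integral_cell (h := fun t Y => ‖N.grad C t Y‖ ^ 2) ?_ ?_
  · exact (((N.continuousOn_grad C).mono (prod_mono_right (subset_univ _))).norm.pow 2)
  · intro t ht Y hY
    rw [N.gradient_map C ht hY]

theorem continuousOn_normSq_convect_cell (N : M.NodalForm u s) (C : M.CellChart s) (hT : 0 < T)
    {D : Data d} (hb : ContinuousOn (fun p : ℝ × Space d => D.b p.1 p.2) M.spaceTime) :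
    ContinuousOn (fun t => normSq (M.cell s t) (convect M D t (u t))) (Icc 0 T) := by
  refine C.continuousOn_integral_cell (h := fun t Y =>
    ‖inner ℝ (D.b t (C.map t Y) - (C.J' t Y + C.a' t)) (N.grad C t Y)‖ ^ 2) ?_ ?_
  · refine (ContinuousOn.inner (𝕜 := ℝ) (ContinuousOn.sub ?_ (ContinuousOn.add ?_ ?_)) ?_).norm.pow 2
    · refine hb.comp (f := fun p : ℝ × Space d => (p.1, C.map p.1 p.2)) ?_ ?_
      · exact continuousOn_fst.prodMk
          (C.continuousOn_map.mono (prod_mono_right (subset_univ _)))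
      · rintro ⟨t, Y⟩ ⟨ht, hY⟩
        refine ⟨ht, cell_subset_domain C.mem_cells t ?_⟩
        rw [C.cell_eq ht]
        exact mem_image_of_mem _ hY
    · exact (C.continuousOn_J'.comp continuousOn_fst fun p hp => hp.1).clm_apply continuousOn_snd
    · exact C.continuousOn_a'.comp continuousOn_fst fun p hp => hp.1
    · exact (N.continuousOn_grad C).mono (prod_mono_right (subset_univ _))
  · intro t ht Y hY
    rw [convect, N.gradient_map C ht hY, C.velocity_map hT ht (interior_subset hY)]

/-- Reynolds' transport theorem on a cell. -/
theorem hasDeriv_normSq_cell (N : M.NodalForm u s) (C : M.CellChart s) (hT : 0 < T)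
    (ht : t ∈ Ioc 0 T) :
    HasDerivWithinAt (fun t => normSq (M.cell s t) (u t))
      (∫ x in M.cell s t, (divergence (M.velocity t) x * u t x ^ 2
        + 2 * (M.aleDeriv u t x * u t x))) (Icc 0 T) t := by
  have ht' := Ioc_subset_Icc_self ht
  let K := convexHull ℝ (s : Set (Space d))
  -- `Q` is the mass matrix on the reference cell. The squared norm is |det J| times a quadratic
  -- form in the nodal values, so nothing is differentiated under an integral.
  let Q : Fin N.n → Fin N.n → ℝ := fun i j => ∫ Y in K, N.φ i Y * N.φ j Y
  have hi : ∀ α β : Fin N.n → ℝ, IntegrableOn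
      (fun Y => (∑ i, α i * N.φ i Y) * ∑ j, β j * N.φ j Y) K := fun α β => by
    refine ContinuousOn.integrableOn_compact (isCompact_refCell s) (Continuous.continuousOn ?_)
    have := fun i => (N.contDiff_φ i).continuous
    fun_prop
  have hQ : ∀ α β : Fin N.n → ℝ, ∫ Y in K, (∑ i, α i * N.φ i Y) * ∑ j, β j * N.φ j Y
      = ∑ i, ∑ j, α i * β j * Q i j := by
    intro α β
    have h1 : ∀ i j, IntegrableOn (fun Y => α i * β j * (N.φ i Y * N.φ j Y)) K := fun i j =>
      (((N.contDiff_φ i).continuous.mul (N.contDiff_φ j).continuous).continuousOn.integrableOn_compact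
        (isCompact_refCell s)).const_mul _
    simp only [Finset.sum_mul_sum]
    simp only [mul_mul_mul_comm]
    rw [integral_finsetSum _ fun i _ => integrable_finsetSum _ fun j _ => h1 i j]
    refine Finset.sum_congr rfl fun i _ => ?_
    rw [integral_finsetSum _ fun j _ => h1 i j]
    exact Finset.sum_congr rfl fun j _ => integral_const_mul _ _
  have hQs : ∀ i j, Q i j = Q j i := fun i j => by simp only [Q, mul_comm]
  have hnorm : ∀ τ ∈ Icc 0 T, normSq (M.cell s τ) (u τ)
      = |(C.J τ).det| * ∑ i, ∑ j, N.c i τ * N.c j τ * Q i j := by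
    intro τ hτ
    rw [← hQ, normSq]
    refine C.integral_cell_of_eq hτ fun Y hY => ?_
    rw [N.map_eq C hτ (interior_subset hY), Real.norm_eq_abs, sq_abs, sq]
  -- The derivative of |det J| is |det J| tr(J' J⁻¹). As J' J⁻¹ is the spatial derivative of w_h,
  -- its trace is the divergence of w_h.
  have hdet := (hasDerivAt_abs (C.det_ne_zero ht')).comp_hasDerivWithinAt t
    (hasDerivWithinAt_det (C.hasDeriv_J t ht') (C.J_mul_I ht') (C.I_mul_J ht'))
  have hsum : HasDerivWithinAt (fun τ => ∑ i, ∑ j, N.c i τ * N.c j τ * Q i j)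
      (∑ i, ∑ j, (N.c' i t * N.c j t + N.c i t * N.c' j t) * Q i j) (Icc 0 T) t :=
    HasDerivWithinAt.fun_sum fun i _ => HasDerivWithinAt.fun_sum fun j _ =>
      ((N.hasDeriv_c i t ht).mul (N.hasDeriv_c j t ht)).mul_const _
  refine ((hdet.fun_mul hsum).congr hnorm (hnorm t ht')).congr_deriv ?_
  have hrhs := C.integral_cell_of_eq (s := s) ht' (g := fun x => divergence (M.velocity t) x * u t x ^ 2
        + 2 * (M.aleDeriv u t x * u t x)) (h := fun Y =>
      LinearMap.trace ℝ (Space d) (C.J' t * C.I t : Space d →L[ℝ] Space d)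
        * ((∑ i, N.c i t * N.φ i Y) * ∑ j, N.c j t * N.φ j Y)
        + 2 * ((∑ i, N.c' i t * N.φ i Y) * ∑ j, N.c j t * N.φ j Y)) fun Y hY => by
    have hx : C.map t Y ∈ interior (M.cell s t) := by
      rw [C.interior_cell ht']; exact mem_image_of_mem _ hY
    rw [divergence_eq_trace (C.hasFDerivAt_velocity hT ht' hx),
      N.map_eq C ht' (interior_subset hY), N.aleDeriv_map C hT ht (interior_subset hY), sq]
  rw [hrhs, integral_add ((hi _ _).const_mul _) ((hi _ _).const_mul _), integral_const_mul,
    integral_const_mul, hQ, hQ]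
  have h2 : ∑ i, ∑ j, (N.c' i t * N.c j t + N.c i t * N.c' j t) * Q i j
      = 2 * ∑ i, ∑ j, N.c' i t * N.c j t * Q i j := by
    have h3 : ∑ i, ∑ j, N.c i t * N.c' j t * Q i j = ∑ i, ∑ j, N.c' i t * N.c j t * Q i j := by
      rw [Finset.sum_comm]
      exact Finset.sum_congr rfl fun i _ => Finset.sum_congr rfl fun j _ => by
        rw [hQs, mul_comm (N.c j t)]
    simp only [add_mul, Finset.sum_add_distrib, h3]
    ring
  rw [h2, mul_comm (LinearMap.trace ℝ (Space d) _) (C.J t).det, ← mul_assoc, sign_mul_self,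
    Function.comp_apply]
  ring

end NodalForm

end MovingMesh

/-! ### Integration by parts for cellwise Lipschitz fields -/

/-- On a compact set, the product of real Lipschitz functions is Lipschitz. -/
theorem exists_lipschitzOnWith_mul {E : Type*} [PseudoMetricSpace E] {K : Set E} (hK : IsCompact K)
    {f g : E → ℝ} {A B : ℝ≥0} (hf : LipschitzOnWith A f K) (hg : LipschitzOnWith B g K) :
    ∃ L, LipschitzOnWith L (fun x => f x * g x) K := by
  obtain ⟨a, ha⟩ := hK.exists_bound_of_continuousOn hf.continuousOn
  obtain ⟨b, hb⟩ := hK.exists_bound_of_continuousOn hg.continuousOn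
  refine ⟨a.toNNReal * B + b.toNNReal * A, LipschitzOnWith.of_dist_le_mul fun x hx y hy => ?_⟩
  have h1 := hf.dist_le_mul x hx y hy
  have h2 := hg.dist_le_mul x hx y hy
  rw [Real.dist_eq] at h1 h2 ⊢
  have h3 : |f x| ≤ a.toNNReal := (ha x hx).trans (Real.le_coe_toNNReal a)
  have h4 : |g y| ≤ b.toNNReal := (hb y hy).trans (Real.le_coe_toNNReal b)
  calc |f x * g x - f y * g y| = |f x * (g x - g y) + g y * (f x - f y)| := by ring_nf
    _ ≤ |f x| * |g x - g y| + |g y| * |f x - f y| := by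
        rw [← abs_mul, ← abs_mul]; exact abs_add_le _ _
    _ ≤ a.toNNReal * (B * dist x y) + b.toNNReal * (A * dist x y) := by gcongr
    _ = _ := by push_cast; ring

namespace MovingMesh

variable {M : MovingMesh d T} {s : Finset (Space d)} {t : ℝ} {k : ℕ}

theorem IsFE.exists_contDiff {v : Space d → ℝ} (hv : M.IsFE k t v) (hs : s ∈ M.cells) :
    ∃ P : Space d → ℝ, ContDiff ℝ 2 P ∧ ∀ x ∈ M.cell s t, v x = P x := by
  obtain ⟨p, -, hp⟩ := hv.polynomial s hs
  exact ⟨_, contDiff_eval_mvPolynomial p, hp⟩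

theorem IsFE.exists_lipschitzOnWith {v : Space d → ℝ} (hv : M.IsFE k t v) (C : M.CellChart s)
    (ht : t ∈ Icc 0 T) : ∃ L, LipschitzOnWith L v (M.cell s t) := by
  obtain ⟨P, hP, hvP⟩ := hv.exists_contDiff C.mem_cells
  obtain ⟨L, hL⟩ := ((hP.of_le one_le_two).locallyLipschitz.locallyLipschitzOn
    (s := M.cell s t)).exists_lipschitzOnWith_of_compact (C.isCompact_cell ht)
  exact ⟨L, fun x hx y hy => by rw [hvP x hx, hvP y hy]; exact hL hx hy⟩

/-- A continuous function on the domain that vanishes on the boundary and is Lipschitz on each cell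
has a globally Lipschitz extension by zero. -/
theorem exists_lipschitzWith_indicator (hT : 0 < T) (ht : t ∈ Icc 0 T) {g : Space d → ℝ}
    (hg : ContinuousOn g (M.domain t)) (h0 : ∀ x ∈ frontier (M.domain t), g x = 0)
    (hL : ∀ s ∈ M.cells, ∃ L, LipschitzOnWith L g (M.cell s t)) :
    ∃ L, LipschitzWith L ((M.domain t).indicator g) := by
  have hclosed := (isCompact_domain hT ht (M := M)).isClosed
  have hcont : Continuous ((M.domain t).indicator g) :=
    continuous_indicator h0 (by rwa [hclosed.closure_eq])
  choose L hL using fun s : M.cells => hL s s.2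
  -- The extra index `none` stands for the closure of the complement. It meets the domain only in
  -- its frontier, so the extension vanishes there identically.
  refine ⟨∑ s, L s, lipschitzWith_of_finite_closed_cover (ι := Option M.cells)
    (S := fun o => o.elim (closure (M.domain t)ᶜ) fun s => M.cell s t) hcont ?_ ?_ ?_⟩
  · rintro (_ | s)
    · exact isClosed_closure
    · obtain ⟨C⟩ := nonempty_cellChart hT s.2
      exact (C.isCompact_cell ht).isClosed
  · refine eq_univ_of_forall fun x => mem_iUnion.2 ?_
    by_cases hx : x ∈ M.domain t
    · rw [domain_eq] at hx
      obtain ⟨s, hs, hx⟩ := mem_iUnion₂.1 hx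
      exact ⟨some ⟨s, hs⟩, hx⟩
    · exact ⟨none, subset_closure hx⟩
  · rintro (_ | s)
    · have h1 : ∀ x ∈ closure (M.domain t)ᶜ, (M.domain t).indicator g x = 0 := by
        intro x hx
        by_cases hxd : x ∈ M.domain t
        · rw [indicator_of_mem hxd]
          refine h0 x ?_
          rw [frontier_eq_closure_inter_closure]
          exact ⟨subset_closure hxd, hx⟩
        · exact indicator_of_notMem hxd _
      intro x hx y hy
      rw [h1 x hx, h1 y hy, edist_self]
      exact zero_le
    · have h1 : LipschitzOnWith (L s) ((M.domain t).indicator g) (M.cell s t) :=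
        fun x hx y hy => by
          rw [indicator_of_mem (cell_subset_domain s.2 t hx),
            indicator_of_mem (cell_subset_domain s.2 t hy)]
          exact hL s hx hy
      exact h1.weaken (Finset.single_le_sum (fun i _ => zero_le) (Finset.mem_univ s))

/-- Integration by parts for the convective term of a finite element function and a continuous,
cellwise Lipschitz field. -/
theorem integral_divergence_mul_sq (hT : 0 < T) (ht : t ∈ Icc 0 T) {v : Space d → ℝ}
    (hv : M.IsFE k t v) {β : Space d → Space d} (hβ : ContinuousOn β (M.domain t))
    (hβL : ∀ s ∈ M.cells, ∃ L, LipschitzOnWith L β (M.cell s t)) :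
    IntegrableOn (fun x => inner ℝ (β x) (gradient v x) * v x) (M.domain t) ∧
    IntegrableOn (fun x => divergence β x * v x ^ 2) (M.domain t) ∧
    ∫ x in M.domain t, divergence β x * v x ^ 2
      = -2 * ∫ x in M.domain t, inner ℝ (β x) (gradient v x) * v x := by
  have hcomp := isCompact_domain hT ht (M := M)
  have hvL : ∀ s ∈ M.cells, ∃ L, LipschitzOnWith L v (M.cell s t) := fun s hs => by
    obtain ⟨C⟩ := nonempty_cellChart hT hs
    exact hv.exists_lipschitzOnWith C ht
  have hβi : ∀ i, ContinuousOn (fun x => β x i) (M.domain t) := fun i =>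
    (EuclideanSpace.proj (𝕜 := ℝ) i).continuous.comp_continuousOn hβ
  obtain ⟨A, hA⟩ := exists_lipschitzWith_indicator hT ht hv.continuousOn hv.boundary hvL
  -- `β` need not vanish on the boundary, but its product with `v` does, so `v * β_i` extends by
  -- zero to a Lipschitz function.
  have hBex : ∀ i, ∃ B, LipschitzWith B ((M.domain t).indicator fun x => v x * β x i) := by
    intro i
    refine exists_lipschitzWith_indicator hT ht (hv.continuousOn.mul (hβi i))
      (fun x hx => by rw [hv.boundary x hx, zero_mul]) fun s hs => ?_
    obtain ⟨C⟩ := nonempty_cellChart hT hs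
    obtain ⟨L, hL⟩ := hvL s hs
    obtain ⟨L', hL'⟩ := hβL s hs
    exact exists_lipschitzOnWith_mul (C.isCompact_cell ht) hL
      ((EuclideanSpace.proj (𝕜 := ℝ) i).lipschitz.comp_lipschitzOnWith hL')
  choose B hB using hBex
  set w := (M.domain t).indicator v with hw
  set q := fun i => (M.domain t).indicator fun x => v x * β x i with hq
  let e : Fin d → Space d := fun i => EuclideanSpace.single i 1
  have hsupp : ∀ f : Space d → ℝ, HasCompactSupport ((M.domain t).indicator f) := fun f =>
    HasCompactSupport.intro hcomp fun x hx => indicator_of_notMem hx _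
  have hparts : ∀ i, ∫ x, lineDeriv ℝ (q i) x (e i) * w x = -∫ x, lineDeriv ℝ w x (e i) * q i x := by
    intro i
    rw [(hB i).integral_lineDeriv_mul_eq hA (hsupp v) (e i), ← integral_neg]
    simp only [lineDeriv_neg, neg_mul, hq]
  have hint1 : ∀ i, Integrable fun x => lineDeriv ℝ (q i) x (e i) * w x := fun i =>
    memLp_one_iff_integrable.1 ((memLp_one_iff_integrable.2
      (hA.continuous.integrable_of_hasCompactSupport (hsupp v))).mul' ((hB i).memLp_lineDeriv (e i)))
  have hint2 : ∀ i, Integrable fun x => lineDeriv ℝ w x (e i) * q i x := fun i =>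
    memLp_one_iff_integrable.1 ((memLp_one_iff_integrable.2
      ((hB i).continuous.integrable_of_hasCompactSupport (hsupp _))).mul' (hA.memLp_lineDeriv (e i)))
  -- Rademacher's theorem in each cell makes `β` differentiable almost everywhere. The second
  -- identity is then the product rule ∂ᵢ(v βᵢ) v = βᵢ ∂ᵢv v + ∂ᵢβᵢ v².
  have hae : ∀ᵐ x ∂(volume.restrict (M.domain t)),
      inner ℝ (β x) (gradient v x) * v x = ∑ i, lineDeriv ℝ w x (e i) * q i x ∧
      inner ℝ (β x) (gradient v x) * v x + divergence β x * v x ^ 2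
        = ∑ i, lineDeriv ℝ (q i) x (e i) * w x := by
    rw [ae_domain_iff hT ht]
    intro s hs
    obtain ⟨C⟩ := nonempty_cellChart hT hs
    obtain ⟨L, hL⟩ := hβL s hs
    obtain ⟨P, hP, hvP⟩ := hv.exists_contDiff hs
    filter_upwards [C.ae_mem_interior_cell ht,
      hL.ae_differentiableWithinAt (C.isCompact_cell ht).measurableSet] with x hx hxd
    have hnhds := mem_interior_iff_mem_nhds.1 hx
    have hβd : DifferentiableAt ℝ β x := hxd.differentiableAt hnhds
    have hxc := interior_subset hx
    have hvd : DifferentiableAt ℝ v x := by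
      refine ((hP.differentiable (by simp)) x).congr_of_eventuallyEq ?_
      filter_upwards [hnhds] with z hz using hvP z hz
    have hβdi : ∀ i, HasFDerivAt (fun z => β z i)
        ((EuclideanSpace.proj (𝕜 := ℝ) i).comp (fderiv ℝ β x)) x := fun i =>
      (EuclideanSpace.proj (𝕜 := ℝ) i).hasFDerivAt.comp x hβd.hasFDerivAt
    have hind : ∀ f : Space d → ℝ, (M.domain t).indicator f =ᶠ[nhds x] f := fun f => by
      filter_upwards [hnhds] with z hz
      exact indicator_of_mem (cell_subset_domain hs t hz) f
    have h1 : ∀ i, lineDeriv ℝ w x (e i) = fderiv ℝ v x (e i) := fun i => by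
      rw [(hind v).lineDeriv_eq, hvd.lineDeriv_eq_fderiv]
    have h2 : ∀ i, lineDeriv ℝ (q i) x (e i)
        = v x * (fderiv ℝ β x (e i)) i + β x i * fderiv ℝ v x (e i) := fun i => by
      rw [(hind _).lineDeriv_eq]
      exact ((hvd.hasFDerivAt.mul (hβdi i)).hasLineDerivAt (e i)).lineDeriv
    have h3 : w x = v x := (hind v).self_of_nhds
    have h4 : ∀ i, q i x = v x * β x i := fun i => (hind _).self_of_nhds
    have h5 : inner ℝ (β x) (gradient v x) = ∑ i, β x i * fderiv ℝ v x (e i) := by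
      rw [real_inner_comm, gradient, InnerProductSpace.toDual_symm_apply]
      have h6 : β x = ∑ i, β x i • e i := by
        ext j
        simp [e, Finset.sum_apply, Pi.single_apply]
      conv_lhs => rw [h6]
      simp
    simp only [h1, h2, h3, h4, h5, divergence, Finset.sum_mul, ← Finset.sum_add_distrib]
    refine ⟨Finset.sum_congr rfl fun i _ => by ring, Finset.sum_congr rfl fun i _ => ?_⟩
    simp only [e]
    ring
  have hI1 : IntegrableOn (fun x => inner ℝ (β x) (gradient v x) * v x) (M.domain t) :=
    (integrable_finsetSum Finset.univ fun i _ => hint2 i).integrableOn.congr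
      (hae.mono fun x hx => hx.1.symm)
  have hI2 : IntegrableOn (fun x => inner ℝ (β x) (gradient v x) * v x + divergence β x * v x ^ 2)
      (M.domain t) :=
    (integrable_finsetSum Finset.univ fun i _ => hint1 i).integrableOn.congr
      (hae.mono fun x hx => hx.2.symm)
  have hI3 : IntegrableOn (fun x => divergence β x * v x ^ 2) (M.domain t) :=
    (hI2.sub hI1).congr (Filter.Eventually.of_forall fun x => by simp)
  refine ⟨hI1, hI3, ?_⟩
  have hE1 : ∫ x in M.domain t, inner ℝ (β x) (gradient v x) * v x
      = ∑ i, ∫ x, lineDeriv ℝ w x (e i) * q i x := by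
    rw [integral_congr_ae (hae.mono fun x hx => hx.1),
      integral_finsetSum _ fun i _ => (hint2 i).integrableOn]
    refine Finset.sum_congr rfl fun i _ => setIntegral_eq_integral_of_forall_compl_eq_zero fun x hx => ?_
    simp [hq, indicator_of_notMem hx]
  have hE2 : ∫ x in M.domain t, (inner ℝ (β x) (gradient v x) * v x + divergence β x * v x ^ 2)
      = ∑ i, ∫ x, lineDeriv ℝ (q i) x (e i) * w x := by
    rw [integral_congr_ae (hae.mono fun x hx => hx.2),
      integral_finsetSum _ fun i _ => (hint1 i).integrableOn]
    refine Finset.sum_congr rfl fun i _ => setIntegral_eq_integral_of_forall_compl_eq_zero fun x hx => ?_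
    simp [hw, indicator_of_notMem hx]
  -- With A = ∫ (β·∇v) v and B = ∫ (∇·β) v², whole-space integration by parts reads A + B = -A.
  rw [integral_add hI1 hI3] at hE2
  simp only [hparts, Finset.sum_neg_distrib, ← hE1] at hE2
  linarith

end MovingMesh

/-! ### Cellwise integrability and the stabilization bound -/

theorem normSq_real (S : Set (Space d)) (g : Space d → ℝ) : normSq S g = ∫ x in S, g x ^ 2 := by
  simp [normSq, sq_abs]

theorem normSq_nonneg {F : Type*} [NormedAddCommGroup F] (S : Set (Space d)) (g : Space d → F) :
    0 ≤ normSq S g :=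
  integral_nonneg fun _ => sq_nonneg _

namespace MovingMesh

variable {M : MovingMesh d T} {s : Finset (Space d)} {t : ℝ} {k : ℕ}

theorem normSq_domain (hT : 0 < T) (ht : t ∈ Icc 0 T) {F : Type*} [NormedAddCommGroup F]
    {g : Space d → F} (hg : ∀ s ∈ M.cells, MemLp g 2 (volume.restrict (M.cell s t))) :
    normSq (M.domain t) g = ∑ s ∈ M.cells, normSq (M.cell s t) g :=
  integral_domain hT ht fun s hs => (hg s hs).integrable_norm_pow two_ne_zero

namespace CellChart

theorem isFiniteMeasure_restrict (C : M.CellChart s) (ht : t ∈ Icc 0 T) :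
    IsFiniteMeasure (volume.restrict (M.cell s t)) :=
  ⟨by simpa using (C.isCompact_cell ht).measure_lt_top⟩

theorem memLp_top_of_continuousOn (C : M.CellChart s) (ht : t ∈ Icc 0 T) {F : Type*}
    [NormedAddCommGroup F] [SecondCountableTopology F] {g : Space d → F}
    (hg : ContinuousOn g (M.cell s t)) : MemLp g ⊤ (volume.restrict (M.cell s t)) :=
  C.memLp_top_cell ht hg fun _ _ => rfl

section FE

variable {v : Space d → ℝ}

theorem memLp_value (C : M.CellChart s) (ht : t ∈ Icc 0 T) (hv : M.IsFE k t v) :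
    MemLp v ⊤ (volume.restrict (M.cell s t)) :=
  C.memLp_top_of_continuousOn ht (hv.continuousOn.mono (cell_subset_domain C.mem_cells t))

theorem gradient_eq {P : Space d → ℝ} (hvP : ∀ x ∈ M.cell s t, v x = P x)
    {x : Space d} (hx : x ∈ interior (M.cell s t)) : gradient v x = gradient P x := by
  have : v =ᶠ[nhds x] P := by
    filter_upwards [mem_interior_iff_mem_nhds.1 hx] with z hz using hvP z hz
  rw [gradient, gradient, this.fderiv_eq]

theorem memLp_gradient (C : M.CellChart s) (ht : t ∈ Icc 0 T) (hv : M.IsFE k t v) :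
    MemLp (gradient v) ⊤ (volume.restrict (M.cell s t)) := by
  obtain ⟨P, hP, hvP⟩ := hv.exists_contDiff C.mem_cells
  exact C.memLp_top_cell ht (contDiff_gradient_continuous hP).continuousOn
    fun x hx => gradient_eq hvP hx

theorem memLp_laplacian (C : M.CellChart s) (ht : t ∈ Icc 0 T) (hv : M.IsFE k t v) :
    MemLp (Laplacian.laplacian v) ⊤ (volume.restrict (M.cell s t)) := by
  obtain ⟨P, hP, hvP⟩ := hv.exists_contDiff C.mem_cells
  refine C.memLp_top_cell ht (contDiff_laplacian_continuous hP).continuousOn fun x hx => ?_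
  have : v =ᶠ[nhds x] P := by
    filter_upwards [mem_interior_iff_mem_nhds.1 hx] with z hz using hvP z hz
  exact (InnerProductSpace.laplacian_congr_nhds this).self_of_nhds

theorem memLp_convect (C : M.CellChart s) (hT : 0 < T) (ht : t ∈ Icc 0 T) (hv : M.IsFE k t v)
    {D : Data d} (hb : ContinuousOn (D.b t) (M.domain t)) :
    MemLp (convect M D t v) ⊤ (volume.restrict (M.cell s t)) := by
  obtain ⟨P, hP, hvP⟩ := hv.exists_contDiff C.mem_cells
  refine C.memLp_top_cell ht (h := fun x => inner ℝ (D.b t x - M.velocity t x) (gradient P x))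
    (((hb.mono (cell_subset_domain C.mem_cells t)).sub (C.continuousOn_velocity hT ht)).inner
      (contDiff_gradient_continuous hP).continuousOn) fun x hx => ?_
  rw [convect, gradient_eq hvP hx]

end FE

end CellChart

/-- Cellwise continuity glues over finitely many closed cells. With the cellwise Lipschitz bound
below, this makes w_h admissible in `integral_divergence_mul_sq`. -/
theorem continuousOn_velocity_domain (hT : 0 < T) (ht : t ∈ Icc 0 T) :
    ContinuousOn (M.velocity t) (M.domain t) := by
  have h1 : M.domain t = ⋃ s : M.cells, M.cell s t := by
    rw [domain_eq, iUnion_subtype]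
  rw [h1]
  refine LocallyFinite.continuousOn_iUnion (locallyFinite_of_finite _) (fun s => ?_) fun s => ?_
  · obtain ⟨C⟩ := nonempty_cellChart hT s.2
    exact (C.isCompact_cell ht).isClosed
  · obtain ⟨C⟩ := nonempty_cellChart hT s.2
    exact C.continuousOn_velocity hT ht

theorem exists_lipschitzOnWith_velocity (hT : 0 < T) (ht : t ∈ Icc 0 T) (hs : s ∈ M.cells) :
    ∃ L, LipschitzOnWith L (M.velocity t) (M.cell s t) := by
  obtain ⟨C⟩ := nonempty_cellChart hT hs
  refine ⟨‖(C.J' t * C.I t : Space d →L[ℝ] Space d)‖₊, fun x hx y hy => ?_⟩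
  rw [C.velocity_eq hT ht hx, C.velocity_eq hT ht hy, edist_add_right]
  refine ((C.J' t * C.I t : Space d →L[ℝ] Space d).lipschitz _ _).trans ?_
  rw [edist_sub_right]

theorem continuousOn_b {D : Data d}
    (hb : ContinuousOn (fun p : ℝ × Space d => D.b p.1 p.2) M.spaceTime) (ht : t ∈ Icc 0 T) :
    ContinuousOn (D.b t) (M.domain t) :=
  hb.comp (f := fun x => (t, x)) (by fun_prop) fun _ hx => ⟨ht, hx⟩

/-- Young's inequality for the stabilization terms on a cell. -/
theorem stabilization_bound (C : M.CellChart s) (hT : 0 < T) (ht : t ∈ Icc 0 T) {D : Data d}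
    (hb : ContinuousOn (D.b t) (M.domain t))
    (hc : MemLp (D.c t) ⊤ (volume.restrict (M.cell s t)))
    (hf : MemLp (D.f t) 2 (volume.restrict (M.cell s t))) {v : Space d → ℝ} (hv : M.IsFE k t v)
    {μ c_inv : ℝ} (hε : 0 < D.ε) (hcinv : 0 < c_inv)
    (hinv : √(normSq (M.cell s t) (Laplacian.laplacian v))
      ≤ c_inv * (M.cellDiam s t)⁻¹ * √(normSq (M.cell s t) (gradient v)))
    (hδ₀ : 0 ≤ D.δ s t) (hδ₁ : D.δ s t * (2 * supNorm (M.cell s t) (D.c t) ^ 2) ≤ μ)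
    (hδ₂ : D.δ s t ≤ M.cellDiam s t ^ 2 / (2 * D.ε * c_inv ^ 2)) :
    D.δ s t * ((∫ x in M.cell s t, D.f t x * convect M D t v x) - ∫ x in M.cell s t,
        (-D.ε * Laplacian.laplacian v x + convect M D t v x + D.c t x * v x) * convect M D t v x)
      ≤ -(D.δ s t * normSq (M.cell s t) (convect M D t v)) / 4
        + D.ε / 2 * normSq (M.cell s t) (gradient v) + μ / 2 * normSq (M.cell s t) v
        + D.δ s t * normSq (M.cell s t) (D.f t) := by
  have := C.isFiniteMeasure_restrict ht
  have hv2 := C.memLp_value ht hv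
  have hg2 := C.memLp_gradient ht hv
  have hl2 := C.memLp_laplacian ht hv
  have hw2 := C.memLp_convect hT ht hv hb
  set δ := D.δ s t
  set S := supNorm (M.cell s t) (D.c t)
  set h := M.cellDiam s t
  have hcS : ∀ᵐ x ∂(volume.restrict (M.cell s t)), |D.c t x| ≤ S := by
    have h1 := ae_le_eLpNormEssSup (f := D.c t) (μ := volume.restrict (M.cell s t))
    filter_upwards [h1] with x hx
    rw [← Real.norm_eq_abs, ← toReal_enorm]
    refine ENNReal.toReal_mono hc.2.ne ?_
    rwa [eLpNorm_exponent_top]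
  have sqi : ∀ {g : Space d → ℝ}, MemLp g 2 (volume.restrict (M.cell s t)) →
      Integrable (fun x => g x ^ 2) (volume.restrict (M.cell s t)) := fun hg => hg.integrable_sq
  have hV := sqi (hv2.mono_exponent le_top)
  have hL := sqi (hl2.mono_exponent le_top)
  have hX := sqi (hw2.mono_exponent le_top)
  have hFF := sqi hf
  have hR : Integrable (fun x => D.f t x * convect M D t v x) (volume.restrict (M.cell s t)) :=
    hf.integrable_mul (q := 2) (hw2.mono_exponent le_top)
  have hS : Integrable (fun x => (-D.ε * Laplacian.laplacian v x + convect M D t v x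
      + D.c t x * v x) * convect M D t v x) (volume.restrict (M.cell s t)) := by
    have h1 : MemLp (fun x => D.c t x * v x) ⊤ (volume.restrict (M.cell s t)) := hv2.mul' hc
    have h2 : MemLp (fun x => -D.ε * Laplacian.laplacian v x + convect M D t v x + D.c t x * v x) ⊤
      (volume.restrict (M.cell s t)) := ((hl2.const_mul (-D.ε)).add hw2).add h1
    exact (hw2.mul' h2 : MemLp _ ⊤ _).integrable le_top
  -- With X = (b - w_h)·∇v, each of the products of X with f, εΔv and cv costs X²/4 by Young's
  -- inequality. Of the term -X² a quarter remains.
  have key : (∫ x in M.cell s t, D.f t x * convect M D t v x) - ∫ x in M.cell s t,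
        (-D.ε * Laplacian.laplacian v x + convect M D t v x + D.c t x * v x) * convect M D t v x
      ≤ -(1 / 4) * normSq (M.cell s t) (convect M D t v) + normSq (M.cell s t) (D.f t)
        + D.ε ^ 2 * normSq (M.cell s t) (Laplacian.laplacian v)
        + S ^ 2 * normSq (M.cell s t) v := by
    simp only [normSq_real]
    rw [← integral_sub hR hS, ← integral_const_mul, ← integral_const_mul, ← integral_const_mul,
      ← integral_add (hX.const_mul _) hFF,
      ← integral_add ((hX.const_mul _).fun_add hFF) (hL.const_mul _),
      ← integral_add (((hX.const_mul _).fun_add hFF).fun_add (hL.const_mul _)) (hV.const_mul _)]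
    refine integral_mono_ae (hR.sub hS)
      ((((hX.const_mul _).fun_add hFF).fun_add (hL.const_mul _)).fun_add (hV.const_mul _)) ?_
    filter_upwards [hcS] with x hx
    have h1 : (D.c t x * v x) ^ 2 ≤ S ^ 2 * v x ^ 2 := by
      rw [mul_pow]
      refine mul_le_mul_of_nonneg_right ?_ (sq_nonneg _)
      rw [← sq_abs]
      exact pow_le_pow_left₀ (abs_nonneg _) hx 2
    nlinarith [sq_nonneg (D.f t x - 1 / 2 * convect M D t v x),
      sq_nonneg (D.ε * Laplacian.laplacian v x - 1 / 2 * convect M D t v x),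
      sq_nonneg (D.c t x * v x + 1 / 2 * convect M D t v x)]
  have hLG : δ * (D.ε ^ 2 * normSq (M.cell s t) (Laplacian.laplacian v))
      ≤ D.ε / 2 * normSq (M.cell s t) (gradient v) := by
    have hG0 := normSq_nonneg (M.cell s t) (gradient v)
    have hL0 := normSq_nonneg (M.cell s t) (Laplacian.laplacian v)
    have h1 : normSq (M.cell s t) (Laplacian.laplacian v)
        ≤ (c_inv * h⁻¹) ^ 2 * normSq (M.cell s t) (gradient v) := by
      have h2 := pow_le_pow_left₀ (Real.sqrt_nonneg _) hinv 2
      rwa [mul_pow, Real.sq_sqrt hL0, Real.sq_sqrt hG0] at h2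
    have h3 : δ * (D.ε ^ 2 * (c_inv * h⁻¹) ^ 2) ≤ D.ε / 2 := by
      -- If `h = 0`, the convention `0⁻¹ = 0` makes the left side vanish.
      rcases eq_or_ne h 0 with h0 | h0
      · rw [h0]; simp; positivity
      · calc δ * (D.ε ^ 2 * (c_inv * h⁻¹) ^ 2)
            ≤ h ^ 2 / (2 * D.ε * c_inv ^ 2) * (D.ε ^ 2 * (c_inv * h⁻¹) ^ 2) := by gcongr
          _ = D.ε / 2 := by field_simp
    calc δ * (D.ε ^ 2 * normSq (M.cell s t) (Laplacian.laplacian v))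
        ≤ δ * (D.ε ^ 2 * ((c_inv * h⁻¹) ^ 2 * normSq (M.cell s t) (gradient v))) := by gcongr
      _ = δ * (D.ε ^ 2 * (c_inv * h⁻¹) ^ 2) * normSq (M.cell s t) (gradient v) := by ring
      _ ≤ _ := by gcongr
  -- The product form of the bound on `δ` avoids dividing by `S`, which may be zero.
  have hSV : δ * (S ^ 2 * normSq (M.cell s t) v) ≤ μ / 2 * normSq (M.cell s t) v := by
    have := mul_le_mul_of_nonneg_right hδ₁ (normSq_nonneg (M.cell s t) v)
    linarith
  have := mul_le_mul_of_nonneg_left key hδ₀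
  linarith

/-! ### The differential energy inequality -/

variable {D : Data d} {u₀ : Space d → ℝ} {u : ℝ → Space d → ℝ}

/-- The differential form of the energy estimate. -/
theorem deriv_normSq_le (hT : 0 < T) (hD : D.IsRegular M) {μ : ℝ} (hμ : 0 < μ)
    (hcoer : ∀ t ∈ Ioc 0 T, ∀ᵐ x ∂(volume.restrict (M.domain t)),
      μ ≤ D.c t x - 1 / 2 * divergence (D.b t) x)
    {c_inv : ℝ} (hc_inv : 0 < c_inv) (hinv : InverseInequality M k c_inv)
    (hδ₁ : ∀ t ∈ Ioc 0 T, ∀ s ∈ M.cells,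
      D.δ s t * (2 * supNorm (M.cell s t) (D.c t) ^ 2) ≤ μ)
    (hδ₂ : ∀ t ∈ Ioc 0 T, ∀ s ∈ M.cells,
      D.δ s t ≤ M.cellDiam s t ^ 2 / (2 * D.ε * c_inv ^ 2))
    (hu : IsSemidiscreteSolution M k D u₀ u) (ht : t ∈ Ioc 0 T) :
    ∑ s ∈ M.cells, ∫ x in M.cell s t, (divergence (M.velocity t) x * u t x ^ 2
        + 2 * (M.aleDeriv u t x * u t x))
      ≤ 2 / μ * normSq (M.domain t) (D.f t)
        + 2 * ∑ s ∈ M.cells, D.δ s t * normSq (M.cell s t) (D.f t)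
        - 1 / 2 * tripleNormSq M D μ t (u t) := by
  have ht' := Ioc_subset_Icc_self ht
  have hv := hu.isFE t ht'
  have hb := continuousOn_b hD.b_continuousOn ht'
  have hsub : ∀ s ∈ M.cells, volume.restrict (M.cell s t) ≤ volume.restrict (M.domain t) :=
    fun s hs => Measure.restrict_mono_set _ (cell_subset_domain hs t)
  have hc : ∀ s ∈ M.cells, MemLp (D.c t) ⊤ (volume.restrict (M.cell s t)) := fun s hs =>
    (hD.c_bounded t ht).mono_measure (hsub s hs)
  have hf : ∀ s ∈ M.cells, MemLp (D.f t) 2 (volume.restrict (M.cell s t)) := fun s hs =>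
    (hD.f_memLp t ht).mono_measure (hsub s hs)
  have chart : ∀ s ∈ M.cells, Nonempty (M.CellChart s) := fun s hs => nonempty_cellChart hT hs
  have hV2 : ∀ s ∈ M.cells, MemLp (u t) 2 (volume.restrict (M.cell s t)) := fun s hs => by
    obtain ⟨C⟩ := chart s hs
    have := C.isFiniteMeasure_restrict ht'
    exact (C.memLp_value ht' hv).mono_exponent le_top
  have hG2 : ∀ s ∈ M.cells, MemLp (gradient (u t)) 2 (volume.restrict (M.cell s t)) := fun s hs => by
    obtain ⟨C⟩ := chart s hs
    have := C.isFiniteMeasure_restrict ht'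
    exact (C.memLp_gradient ht' hv).mono_exponent le_top
  have hA2 : ∀ s ∈ M.cells, MemLp (M.aleDeriv u t) 2 (volume.restrict (M.cell s t)) := fun s hs => by
    obtain ⟨C⟩ := chart s hs
    obtain ⟨N⟩ := nonempty_nodalForm hu C
    have := C.isFiniteMeasure_restrict ht'
    have hφ := fun i => (N.contDiff_φ i).continuous
    have hcont : Continuous fun x => ∑ i, N.c' i t * N.φ i (C.I t (x - C.a t)) := by fun_prop
    exact (C.memLp_top_cell ht' hcont.continuousOn fun x hx =>
      N.aleDeriv_eq C hT ht (interior_subset hx)).mono_exponent le_top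
  have hIA : IntegrableOn (fun x => M.aleDeriv u t x * u t x) (M.domain t) :=
    (integrableOn_domain_iff hT ht').2 fun s hs => (hA2 s hs).integrable_mul (hV2 s hs)
  have hIF : IntegrableOn (fun x => D.f t x * u t x) (M.domain t) :=
    (integrableOn_domain_iff hT ht').2 fun s hs => (hf s hs).integrable_mul (hV2 s hs)
  have hIV : IntegrableOn (fun x => u t x ^ 2) (M.domain t) :=
    (integrableOn_domain_iff hT ht').2 fun s hs => (hV2 s hs).integrable_sq
  have hIFF : IntegrableOn (fun x => D.f t x ^ 2) (M.domain t) :=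
    (integrableOn_domain_iff hT ht').2 fun s hs => (hf s hs).integrable_sq
  have hIC : IntegrableOn (fun x => D.c t x * u t x * u t x) (M.domain t) :=
    (integrableOn_domain_iff hT ht').2 fun s hs => by
      have h1 : MemLp (fun x => D.c t x * u t x) 2 (volume.restrict (M.cell s t)) :=
        (hV2 s hs).mul' (hc s hs)
      exact h1.integrable_mul (hV2 s hs)
  obtain ⟨hIB, hIBd, hBeq⟩ := integral_divergence_mul_sq hT ht' hv hb fun s hs => by
    obtain ⟨L, hL⟩ := hD.b_lipschitz t ht
    exact ⟨L, hL.mono (cell_subset_domain hs t)⟩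
  obtain ⟨hIW, hIWd, hWeq⟩ := integral_divergence_mul_sq hT ht' hv
    (continuousOn_velocity_domain hT ht') fun s hs => exists_lipschitzOnWith_velocity hT ht' hs
  -- The divergence of w_h becomes twice the mesh convection term of the discrete equation; this is
  -- where the mesh velocity cancels.
  have hlhs : ∑ s ∈ M.cells, ∫ x in M.cell s t, (divergence (M.velocity t) x * u t x ^ 2
        + 2 * (M.aleDeriv u t x * u t x))
      = -2 * (∫ x in M.domain t, inner ℝ (M.velocity t x) (gradient (u t) x) * u t x)
        + 2 * ∫ x in M.domain t, M.aleDeriv u t x * u t x := by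
    rw [← hWeq, ← integral_const_mul, ← integral_add hIWd (hIA.const_mul 2)]
    exact (integral_domain hT ht' ((integrableOn_domain_iff hT ht').1
      (hIWd.add (hIA.const_mul 2)))).symm
  have hcoer' : μ * normSq (M.domain t) (u t)
      ≤ (∫ x in M.domain t, inner ℝ (D.b t x) (gradient (u t) x) * u t x)
        + ∫ x in M.domain t, D.c t x * u t x * u t x := by
    have h1 : μ * normSq (M.domain t) (u t) ≤ ∫ x in M.domain t,
        (D.c t x * u t x * u t x - 1 / 2 * (divergence (D.b t) x * u t x ^ 2)) := by
      rw [normSq_real, ← integral_const_mul]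
      refine integral_mono_ae (hIV.const_mul μ) (hIC.sub (hIBd.const_mul (1 / 2))) ?_
      filter_upwards [hcoer t ht] with x hx
      have := mul_le_mul_of_nonneg_right hx (sq_nonneg (u t x))
      linarith
    rw [integral_sub hIC (hIBd.const_mul (1 / 2)), integral_const_mul, hBeq] at h1
    linarith
  -- The Young weight leaves μ/4 of the reaction: coercivity gives μ and the stabilization takes
  -- μ/2.
  have hsource : ∫ x in M.domain t, D.f t x * u t x
      ≤ 1 / μ * normSq (M.domain t) (D.f t) + μ / 4 * normSq (M.domain t) (u t) := by
    rw [normSq_real, normSq_real, ← integral_const_mul, ← integral_const_mul,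
      ← integral_add (hIFF.const_mul _) (hIV.const_mul _)]
    refine integral_mono hIF ((hIFF.const_mul _).add (hIV.const_mul _)) fun x => ?_
    have h1 : 1 / μ * D.f t x ^ 2 + μ / 4 * u t x ^ 2 - D.f t x * u t x
        = 1 / μ * (D.f t x - μ / 2 * u t x) ^ 2 := by
      field_simp; ring
    have h2 : 0 ≤ 1 / μ * (D.f t x - μ / 2 * u t x) ^ 2 := by positivity
    simp only
    linarith
  have hstab := Finset.sum_le_sum fun s hs => by
    obtain ⟨C⟩ := chart s hs
    exact stabilization_bound C hT ht' hb (hc s hs) (hf s hs) hv hD.ε_pos hc_inv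
      (hinv t ht _ hv s hs) (hD.δ_nonneg s hs t ht) (hδ₁ t ht s hs) (hδ₂ t ht s hs)
  simp only [mul_sub, Finset.sum_sub_distrib, Finset.sum_add_distrib, ← Finset.mul_sum, neg_div,
    ← Finset.sum_div, Finset.sum_neg_distrib, ← normSq_domain hT ht' hV2,
    ← normSq_domain hT ht' hG2] at hstab
  have heq := hu.equation t ht _ hv
  have hgrad : ∫ x in M.domain t, inner ℝ (gradient (u t) x) (gradient (u t) x)
      = normSq (M.domain t) (gradient (u t)) := by
    simp only [real_inner_self_eq_norm_sq]; rfl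
  rw [aSUPG, hgrad] at heq
  rw [hlhs, tripleNormSq]
  -- After doubling, μ/2 of ‖u‖² and half of the streamline term remain, as required. The diffusion
  -- keeps its full ε‖∇u‖², and nonnegativity lets half of it be dropped.
  have hG0 := mul_nonneg hD.ε_pos.le (normSq_nonneg (M.domain t) (gradient (u t)))
  have h2μ : 2 / μ * normSq (M.domain t) (D.f t) = 2 * (1 / μ * normSq (M.domain t) (D.f t)) := by
    ring
  linarith

end MovingMesh

/-! ### Continuity, measurability and integrability in time -/

namespace MovingMesh

variable {M : MovingMesh d T} {s : Finset (Space d)} {t : ℝ} {k : ℕ}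

namespace CellChart

/-- The space-time trace of a moving cell. -/
def trace (_ : M.CellChart s) : Set (ℝ × Space d) :=
  {p | p.1 ∈ Icc 0 T ∧ p.2 ∈ M.cell s p.1}

theorem isCompact_trace (C : M.CellChart s) : IsCompact C.trace := by
  have h1 : C.trace = (fun p : ℝ × Space d => (p.1, C.map p.1 p.2)) ''
      (Icc 0 T ×ˢ convexHull ℝ (s : Set (Space d))) := by
    ext ⟨t, x⟩
    simp only [trace, mem_ofPred_eq, mem_image, mem_prod, Prod.exists, Prod.mk.injEq]
    constructor
    · rintro ⟨ht, hx⟩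
      rw [C.cell_eq ht] at hx
      obtain ⟨Y, hY, rfl⟩ := hx
      exact ⟨t, Y, ⟨ht, hY⟩, rfl, rfl⟩
    · rintro ⟨τ, Y, ⟨ht, hY⟩, rfl, rfl⟩
      rw [C.cell_eq ht]
      exact ⟨ht, mem_image_of_mem _ hY⟩
  rw [h1]
  exact (isCompact_Icc.prod (isCompact_refCell s)).image_of_continuousOn
    (continuousOn_fst.prodMk (C.continuousOn_map.mono (prod_mono_right (subset_univ _))))

/-- Fubini's theorem on the space-time trace of the cell, which is measurable because it is the
compact image of a cylinder. -/
theorem integrableOn_normSq (C : M.CellChart s) {f : ℝ → Space d → ℝ}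
    (hf : MemLp (fun p : ℝ × Space d => f p.1 p.2) 2 (volume.restrict M.spaceTime)) :
    IntegrableOn (fun t => normSq (M.cell s t) (f t)) (Icc 0 T) := by
  have hsub : C.trace ⊆ M.spaceTime := fun p hp => ⟨hp.1, cell_subset_domain C.mem_cells _ hp.2⟩
  have h1 : IntegrableOn (fun p : ℝ × Space d => f p.1 p.2 ^ 2) C.trace :=
    (hf.mono_measure (Measure.restrict_mono_set _ hsub)).integrable_sq
  rw [← integrable_indicator_iff C.isCompact_trace.measurableSet, Measure.volume_eq_prod] at h1
  refine (h1.integral_prod_left.integrableOn (s := Icc 0 T)).congr ?_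
  filter_upwards [ae_restrict_mem measurableSet_Icc] with t ht
  rw [normSq_real, ← integral_indicator (C.isCompact_cell ht).measurableSet]
  refine integral_congr_ae (Filter.Eventually.of_forall fun x => ?_)
  by_cases hx : x ∈ M.cell s t
  · have : (t, x) ∈ C.trace := ⟨ht, hx⟩
    simp [hx, this]
  · have : (t, x) ∉ C.trace := fun h => hx h.2
    simp [hx, this]

theorem exists_cellDiam_le (C : M.CellChart s) :
    ∃ R, 0 ≤ R ∧ ∀ t ∈ Icc 0 T, M.cellDiam s t ≤ R := by
  have hbd := (C.isCompact_trace.image continuous_snd).isBounded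
  refine ⟨Metric.diam (Prod.snd '' C.trace), Metric.diam_nonneg, fun t ht => ?_⟩
  exact Metric.diam_mono (fun x hx => ⟨(t, x), ⟨ht, hx⟩, rfl⟩) hbd

end CellChart

variable {D : Data d} {u₀ : Space d → ℝ} {u : ℝ → Space d → ℝ}

theorem integrableOn_normSq_domain (hT : 0 < T) (hD : D.IsRegular M) :
    IntegrableOn (fun t => normSq (M.domain t) (D.f t)) (Ioc 0 T) := by
  have h1 : IntegrableOn (fun t => ∑ s ∈ M.cells, normSq (M.cell s t) (D.f t)) (Ioc 0 T) := by
    refine integrable_finsetSum _ fun s hs => ?_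
    obtain ⟨C⟩ := nonempty_cellChart hT hs
    exact (C.integrableOn_normSq hD.f_memLp_spaceTime).mono_set Ioc_subset_Icc_self
  refine h1.congr ?_
  filter_upwards [ae_restrict_mem measurableSet_Ioc] with t ht
  exact (normSq_domain hT (Ioc_subset_Icc_self ht) fun s hs => (hD.f_memLp t ht).mono_measure
    (Measure.restrict_mono_set _ (cell_subset_domain hs t))).symm

/-- The moving cell stays in a bounded set, so the diameter condition bounds the merely measurable
`δ` uniformly in time. -/
theorem integrableOn_delta_mul_normSq (hT : 0 < T) (hD : D.IsRegular M) {c_inv : ℝ}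
    (hδ₂ : ∀ t ∈ Ioc 0 T, ∀ s ∈ M.cells,
      D.δ s t ≤ M.cellDiam s t ^ 2 / (2 * D.ε * c_inv ^ 2)) :
    IntegrableOn (fun t => ∑ s ∈ M.cells, D.δ s t * normSq (M.cell s t) (D.f t)) (Ioc 0 T) := by
  refine integrable_finsetSum _ fun s hs => ?_
  obtain ⟨C⟩ := nonempty_cellChart hT hs
  obtain ⟨R, hR, hdiam⟩ := C.exists_cellDiam_le
  have hε := hD.ε_pos
  refine ((C.integrableOn_normSq hD.f_memLp_spaceTime).mono_set Ioc_subset_Icc_self).bdd_mul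
    (c := R ^ 2 / (2 * D.ε * c_inv ^ 2)) (hD.δ_measurable s hs).aestronglyMeasurable ?_
  filter_upwards [ae_restrict_mem measurableSet_Ioc] with t ht
  rw [Real.norm_of_nonneg (hD.δ_nonneg s hs t ht)]
  refine (hδ₂ t ht s hs).trans ?_
  have h0 : 0 ≤ M.cellDiam s t := Metric.diam_nonneg
  have h1 := hdiam t (Ioc_subset_Icc_self ht)
  gcongr

theorem memLp_two_value (hT : 0 < T) (hu : IsSemidiscreteSolution M k D u₀ u) (ht : t ∈ Icc 0 T)
    (hs : s ∈ M.cells) : MemLp (u t) 2 (volume.restrict (M.cell s t)) := by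
  obtain ⟨C⟩ := nonempty_cellChart hT hs
  have := C.isFiniteMeasure_restrict ht
  exact (C.memLp_value ht (hu.isFE t ht)).mono_exponent le_top

theorem memLp_two_gradient (hT : 0 < T) (hu : IsSemidiscreteSolution M k D u₀ u)
    (ht : t ∈ Icc 0 T) (hs : s ∈ M.cells) :
    MemLp (gradient (u t)) 2 (volume.restrict (M.cell s t)) := by
  obtain ⟨C⟩ := nonempty_cellChart hT hs
  have := C.isFiniteMeasure_restrict ht
  exact (C.memLp_gradient ht (hu.isFE t ht)).mono_exponent le_top

theorem continuousOn_normSq_domain (hT : 0 < T) (hu : IsSemidiscreteSolution M k D u₀ u) :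
    ContinuousOn (fun t => normSq (M.domain t) (u t)) (Icc 0 T) := by
  refine (continuousOn_finsetSum M.cells fun s hs => ?_).congr fun t ht =>
    normSq_domain hT ht fun s hs => memLp_two_value hT hu ht hs
  obtain ⟨C⟩ := nonempty_cellChart hT hs
  obtain ⟨N⟩ := nonempty_nodalForm hu C
  exact N.continuousOn_normSq_cell C

theorem continuousOn_normSq_gradient_domain (hT : 0 < T)
    (hu : IsSemidiscreteSolution M k D u₀ u) :
    ContinuousOn (fun t => normSq (M.domain t) (gradient (u t))) (Icc 0 T) := by
  refine (continuousOn_finsetSum M.cells fun s hs => ?_).congr fun t ht =>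
    normSq_domain hT ht fun s hs => memLp_two_gradient hT hu ht hs
  obtain ⟨C⟩ := nonempty_cellChart hT hs
  obtain ⟨N⟩ := nonempty_nodalForm hu C
  exact N.continuousOn_normSq_gradient_cell C

/-- Reynolds' transport theorem on the moving domain. -/
theorem hasDeriv_normSq_domain (hT : 0 < T) (hu : IsSemidiscreteSolution M k D u₀ u)
    (ht : t ∈ Ioc 0 T) :
    HasDerivWithinAt (fun t => normSq (M.domain t) (u t))
      (∑ s ∈ M.cells, ∫ x in M.cell s t, (divergence (M.velocity t) x * u t x ^ 2
        + 2 * (M.aleDeriv u t x * u t x))) (Icc 0 T) t := by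
  have h1 : ∀ t ∈ Icc 0 T, normSq (M.domain t) (u t)
      = ∑ s ∈ M.cells, normSq (M.cell s t) (u t) := fun t ht =>
    normSq_domain hT ht fun s hs => memLp_two_value hT hu ht hs
  refine (HasDerivWithinAt.fun_sum fun s hs => ?_).congr h1 (h1 t (Ioc_subset_Icc_self ht))
  obtain ⟨C⟩ := nonempty_cellChart hT hs
  obtain ⟨N⟩ := nonempty_nodalForm hu C
  exact N.hasDeriv_normSq_cell C hT ht

/-- Every ingredient except `δ` is continuous in time up to `t = 0`; `δ` is only almost everywhere
measurable. -/
theorem aemeasurable_tripleNormSq (hT : 0 < T) (hD : D.IsRegular M)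
    (hu : IsSemidiscreteSolution M k D u₀ u) (μ : ℝ) :
    AEMeasurable (fun t => tripleNormSq M D μ t (u t)) (volume.restrict (Ioc 0 T)) := by
  have cm : ∀ {g : ℝ → ℝ}, ContinuousOn g (Icc 0 T) → AEMeasurable g (volume.restrict (Ioc 0 T)) :=
    fun hg => (hg.mono Ioc_subset_Icc_self).aemeasurable measurableSet_Ioc
  refine AEMeasurable.add (AEMeasurable.add ?_ (Finset.aemeasurable_fun_sum _ fun s hs => ?_)) ?_
  · exact (cm (continuousOn_normSq_gradient_domain hT hu)).const_mul _
  · obtain ⟨C⟩ := nonempty_cellChart hT hs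
    obtain ⟨N⟩ := nonempty_nodalForm hu C
    exact (hD.δ_measurable s hs).mul
      (cm (N.continuousOn_normSq_convect_cell C hT hD.b_continuousOn))
  · exact (cm (continuousOn_normSq_domain hT hu)).const_mul _

end MovingMesh

end ALESUPG

/-! ### The stability estimate -/

open ALESUPG in
theorem mainTheorem4 {d : ℕ} (hd : d = 2 ∨ d = 3) {T : ℝ} (hT : 0 < T)
    (M : MovingMesh d T) (k : ℕ) (D : Data d) (hD : D.IsRegular M)
    (μ : ℝ) (hμ : 0 < μ)
    (hcoer : ∀ t ∈ Ioc 0 T, ∀ᵐ x ∂(volume.restrict (M.domain t)),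
      μ ≤ D.c t x - 1 / 2 * divergence (D.b t) x)
    (c_inv : ℝ) (hc_inv : 0 < c_inv) (hinv : InverseInequality M k c_inv)
    (hδ₁ : ∀ t ∈ Ioc 0 T, ∀ s ∈ M.cells,
      D.δ s t * (2 * supNorm (M.cell s t) (D.c t) ^ 2) ≤ μ)
    (hδ₂ : ∀ t ∈ Ioc 0 T, ∀ s ∈ M.cells,
      D.δ s t ≤ M.cellDiam s t ^ 2 / (2 * D.ε * c_inv ^ 2))
    (u₀ : Space d → ℝ) (hu₀ : MemLp u₀ 2 (volume.restrict (M.domain 0)))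
    (u : ℝ → Space d → ℝ) (hu : IsSemidiscreteSolution M k D u₀ u) :
    IntervalIntegrable (fun t => tripleNormSq M D μ t (u t)) volume 0 T ∧
    ∀ τ ∈ Icc 0 T,
      normSq (M.domain τ) (u τ) + 1 / 2 * ∫ t in (0 : ℝ)..τ, tripleNormSq M D μ t (u t)
        ≤ normSq (M.domain 0) (u 0)
          + 2 / μ * (∫ t in (0 : ℝ)..τ, normSq (M.domain t) (D.f t))
          + 2 * ∫ t in (0 : ℝ)..τ, ∑ s ∈ M.cells, D.δ s t * normSq (M.cell s t) (D.f t) := by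
  have hF₁ := MovingMesh.integrableOn_normSq_domain hT hD
  have hF₂ := MovingMesh.integrableOn_delta_mul_normSq hT hD hδ₂
  have hN : ∀ t ∈ Ioc 0 T, 0 ≤ tripleNormSq M D μ t (u t) := fun t ht => by
    have h3 : 0 ≤ ∑ s ∈ M.cells, D.δ s t * normSq (M.cell s t) (convect M D t (u t)) :=
      Finset.sum_nonneg fun s hs => mul_nonneg (hD.δ_nonneg s hs t ht) (normSq_nonneg _ _)
    have h4 := mul_nonneg hD.ε_pos.le (normSq_nonneg (M.domain t) (gradient (u t)))
    have h5 := mul_nonneg hμ.le (normSq_nonneg (M.domain t) (u t))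
    rw [tripleNormSq]
    linarith
  obtain ⟨h1, h2⟩ := energy_bound hT (MovingMesh.continuousOn_normSq_domain hT hu)
    (fun t ht => MovingMesh.hasDeriv_normSq_domain hT hu ht)
    (MovingMesh.aemeasurable_tripleNormSq hT hD hu μ) hN
    ((hF₁.const_mul (2 / μ)).add (hF₂.const_mul 2))
    (fun t ht => MovingMesh.deriv_normSq_le hT hD hμ hcoer hc_inv hinv hδ₁ hδ₂ hu ht)
  refine ⟨h1, fun τ hτ => (h2 τ hτ).trans_eq ?_⟩
  have hsub : Ioc 0 τ ⊆ Ioc 0 T := Ioc_subset_Ioc_right hτ.2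
  have hi : ∀ {g : ℝ → ℝ}, IntegrableOn g (Ioc 0 T) → IntervalIntegrable g volume 0 τ :=
    fun hg => (intervalIntegrable_iff_integrableOn_Ioc_of_le hτ.1).2 (hg.mono_set hsub)
  simp only [Pi.add_apply]
  rw [intervalIntegral.integral_add (hi (hF₁.const_mul _)) (hi (hF₂.const_mul _)),
    intervalIntegral.integral_const_mul, intervalIntegral.integral_const_mul, ← add_assoc]
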